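/- Let $\mathbb{K}$ be a perfect field, let $F\in\mathbb{K}[[x]][y]$ be monic of degree $d>0$ in $y$, and assume that the characteristic of $\mathbb{K}$ is $0$ or greater than $d$. *Newton polygons.* For a polynomial $H=\sum_i a_i(x)y^i$ over a power series ring $\mathbb{L}[[x]]$, the Newton polygon $\mathcal{N}(H)$ is the lower convex hull of the points $(i,\mathrm{val}_x(a_i))$, $0\le i\le \deg H$, points with infinite ordinate being ignored. Its boundary polynomial is $\bar H=\sum_{(i,j)\in\mathcal{N}(H)}a_{ij}x^jy^i$, where $a_i=\sum_j a_{ij}x^j$. A monic $H$ is degenerated over $\mathbb{L}$ with edge data $(q,m,P,N)$ if $\mathcal{N}(H)$ is a segment of slope $-m/q$ with $q\ge 1$, $m\ge 0$ coprime, $N\ge1$, $P\in\mathbb{L}[Z]$ is monic and irreducible, and $\bar H=c\,\bigl(P(y^q/x^m)\,x^{m\deg P}\bigr)^N$ for some $c\in\mathbb{L}^\times$. *Transforms.* Put $\mathbb{K}_0=\mathbb{K}$ and $G_0=F$. Given $G_i\in\mathbb{K}_i[[x]][y]$ monic of degree $n$ with $y^{n-1}$-coefficient $g$, let $c_i=-g/n$,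 $\tau_i(x,y)=(x,y+c_i(x))$ and $H_i=\tau_i^*G_i=G_i(x,y+c_i(x))$. If $n>1$ and $H_i$ is degenerated over $\mathbb{K}_i$ with edge data $(q_{i+1},m_{i+1},P_{i+1},N_{i+1})$, put $\ell_{i+1}=\deg P_{i+1}$, $\mathbb{K}_{i+1}=\mathbb{K}_i[Z]/(P_{i+1}(Z))$, $z_{i+1}=Z\bmod P_{i+1}$; let $s_{i+1},t_{i+1}$ be the integers with $q_{i+1}s_{i+1}-m_{i+1}t_{i+1}=1$, $0\le t_{i+1}<q_{i+1}$; let $$\sigma_{i+1}(x,y)=\bigl(z_{i+1}^{t_{i+1}}x^{q_{i+1}},\;x^{m_{i+1}}(y+z_{i+1}^{s_{i+1}})\bigr),$$ and let $G_{i+1}$ be the Weierstrass polynomial (in the sense of the Weierstrass preparation theorem in $\mathbb{K}_{i+1}[[x,y]]$) of $\sigma_{i+1}^*H_i/x^{q_{i+1}m_{i+1}\ell_{i+1}N_{i+1}}$. Let $k\ge0$ be such that $H_0,\dots,H_{k-1}$ are degenerated in this way, with $\deg H_i>1$ for $i<k$, so that $H_0,\dots,H_k$ are defined, and let $N_k=\deg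 H_k$. Put $\pi_0=\tau_0$ and $\pi_i=\pi_{i-1}\circ\sigma_i\circ\tau_i$ for $1\le i\le k$. For $0\le i\le k$ let $\phi_i\in\mathbb{K}[[x]][y]$ be the $i$-th minimal polynomial of $F$, i.e. the unique monic irreducible polynomial that vanishes at $\pi_i(x,0)$, and let $\phi_{-1}=x$. For $G\in\mathbb{K}[[x]][y]$ let $v_k(G)=\mathrm{val}_x(\pi_k^*G)$ be the largest exponent $e$ such that $x^e$ divides $\pi_k^*G$ in $\mathbb{K}_k[[x]][y]$ ($\infty$ if $G=0$). *Expansion.* Let $$\mathcal{B}=\{B=(b_{-1},\dots,b_k)\in\mathbb{N}^{k+2}\;:\;b_{i-1}<q_i\ell_i,\ 1\le i\le k\},\qquad \Phi^B=\prod_{i=-1}^k\phi_i^{b_i},$$ let $F=\sum_{B\in\mathcal{B}}f_B\Phi^B$ with $f_B\in\mathbb{K}$ be the ($x$-adically convergent) $\Phi$-adic expansion of $F$, and let $V=(v_k(\phi_{-1}),\dots,v_k(\phi_k))$. For $i\in\mathbb{N}$ put $$w_i=\min\{\langle B,V\rangle\;:\;b_k=i,\ f_B\neq0\}-v_k(F),$$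 with $w_i=\infty$ if the minimum is over the empty set. **Theorem.** The Newton polygon of $H_k$ is the lower convex hull of the points $(i,w_i)$, $0\le i\le N_k$ (points with $w_i=\infty$ being ignored). -/

import Mathlib

open scoped Polynomial PowerSeries

namespace ARNP

/-! ### Newton polygons -/

/-- The lower convex hull of a set of points of the plane: the lower boundary of its convex hull. -/
def lowerHull (S : Set (ℝ × ℝ)) : Set (ℝ × ℝ) :=
  {p | p ∈ convexHull ℝ S ∧ ∀ v : ℝ, (p.1, v) ∈ convexHull ℝ S → p.2 ≤ v}

/-- The points `(i, w i)` for `0 ≤ i ≤ n`; the indices with `w i = ∞` give no point. -/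
def points (w : ℕ → WithTop ℤ) (n : ℕ) : Set (ℝ × ℝ) :=
  {p | ∃ i : ℕ, i ≤ n ∧ ∃ v : ℤ, w i = (v : WithTop ℤ) ∧ p = ((i : ℝ), (v : ℝ))}

variable {L M : Type*} [Field L] [Field M]

/-- The Newton polygon of `H = ∑ aᵢ(x) yⁱ`: the lower convex hull of the points
`(i, val aᵢ)`, `0 ≤ i ≤ deg H`. -/
noncomputable def newtonPolygon (H : L⟦X⟧[X]) : Set (ℝ × ℝ) :=
  lowerHull (points (fun i => WithTop.map (fun n : ℕ => (n : ℤ)) (H.coeff i).order) H.natDegree)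

open Classical in
/-- The boundary polynomial: the sum of the terms `aᵢⱼ xʲ yⁱ` of `H` whose exponent `(i, j)` lies on
the Newton polygon. -/
noncomputable def boundaryPoly (H : L⟦X⟧[X]) : L⟦X⟧[X] :=
  ∑ i ∈ Finset.range (H.natDegree + 1), Polynomial.monomial i
    (PowerSeries.mk fun j =>
      if ((i : ℝ), (j : ℝ)) ∈ newtonPolygon H then PowerSeries.coeff j (H.coeff i) else 0)

/-- The quasi-homogeneous polynomial `P(y^q / x^m) x^(m deg P)`. -/
noncomputable def quasiHom (P : L[X]) (q m : ℕ) : L⟦X⟧[X] :=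
  ∑ j ∈ Finset.range (P.natDegree + 1), Polynomial.monomial (q * j)
    (PowerSeries.C (P.coeff j) * PowerSeries.X ^ (m * (P.natDegree - j)))

/-- `H` is degenerated over `L` with edge data `(q, m, P, N)`. (The Newton polygon of a monic
polynomial has no edge of positive slope, so that `m` is a natural number. A Newton polygon
that is a single point has no slope, hence no edge data.) -/
structure IsEdgeData (H : L⟦X⟧[X]) (q m : ℕ) (P : L[X]) (N : ℕ) : Prop where
  q_pos : 0 < q
  coprime : Nat.Coprime q m
  monic : P.Monic
  irreducible : Irreducible P
  N_pos : 0 < N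
  /-- The Newton polygon is straight, of slope `-m/q`. -/
  straight : newtonPolygon H =
    segment ℝ ((0 : ℝ), ((m * P.natDegree * N : ℕ) : ℝ)) (((q * P.natDegree * N : ℕ) : ℝ), (0 : ℝ))
  boundary : ∃ c : L, c ≠ 0 ∧
    boundaryPoly H = Polynomial.C (PowerSeries.C c) * quasiHom P q m ^ N

/-! ### The Abhyankar shift and the Puiseux transform -/

/-- `c(x) = -g_{N-1}(x) / N` for `G` of degree `N`. -/
noncomputable def shiftCoeff (G : L⟦X⟧[X]) : L⟦X⟧ :=
  -(PowerSeries.C ((G.natDegree : L)⁻¹) * G.coeff (G.natDegree - 1))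

/-- The pull-back `τ^*` by `τ(x, y) = (x, y + c(x))`. -/
noncomputable def tauPull (c : L⟦X⟧) : L⟦X⟧[X] →+* L⟦X⟧[X] :=
  Polynomial.compRingHom (Polynomial.X + Polynomial.C c)

/-- The substitution `a(x) ↦ a(u x^q)`, with extension of scalars from `L` to `M`. -/
noncomputable def xPull [Algebra L M] (q : ℕ+) (u : M) : L⟦X⟧ →+* M⟦X⟧ :=
  ((PowerSeries.expand (R := M) (q : ℕ) q.ne_zero : M⟦X⟧ →+* M⟦X⟧).comp
    (PowerSeries.rescale u)).comp (PowerSeries.map (algebraMap L M))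

/-- The pull-back `σ^*` by `σ(x, y) = (z^t x^q, x^m (y + z^s))`. -/
noncomputable def sigmaPull [Algebra L M] (q : ℕ+) (m s t : ℕ) (z : M) :
    L⟦X⟧[X] →+* M⟦X⟧[X] :=
  Polynomial.eval₂RingHom (Polynomial.C.comp (xPull q (z ^ t)))
    (Polynomial.C (PowerSeries.X ^ m) * (Polynomial.X + Polynomial.C (PowerSeries.C (z ^ s))))

/-- The first `k` iterations of the algorithm `ARNP` on the monic polynomial `F` over `𝕂 0`, all of
which meet a degenerated polynomial, together with the `k`-th Weierstrass polynomial. The index `i`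
of `q, m, P, N, s, t, z` starts at `0`: `q i` is the ramification index found at iteration
`i + 1`, etc. Entries with index `≥ k` (`> k` for `G`) are not constrained and play no role. -/
structure Run (𝕂 : ℕ → Type*) [∀ i, Field (𝕂 i)] [∀ i, Algebra (𝕂 i) (𝕂 (i + 1))]
    (F : (𝕂 0)⟦X⟧[X]) (k : ℕ) where
  /-- The Weierstrass polynomials before the Abhyankar shift (`F` itself at the first call). -/
  G : ∀ i, (𝕂 i)⟦X⟧[X]
  q : ℕ → ℕ+
  m : ℕ → ℕ
  P : ∀ i, (𝕂 i)[X]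
  N : ℕ → ℕ
  s : ℕ → ℕ
  t : ℕ → ℕ
  z : ∀ i, 𝕂 (i + 1)
  G_zero : G 0 = F
  /-- The loop goes on only while the degree is greater than `1`. -/
  one_lt : ∀ i < k, 1 < (G i).natDegree
  edge : ∀ i < k, IsEdgeData (tauPull (shiftCoeff (G i)) (G i)) (q i) (m i) (P i) (N i)
  /-- Bézout relation `q s - m t = 1`, `0 ≤ t < q`. -/
  bezout : ∀ i < k, (q i : ℕ) * s i = m i * t i + 1 ∧ t i < q i
  /-- `𝕂 (i + 1) = 𝕂 i [Z] / (P i)`, and `z i` is the class of `Z`. -/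
  root : ∀ i < k, Polynomial.aeval (z i) (P i) = 0
  adjoin : ∀ i < k, Algebra.adjoin (𝕂 i) {z i} = ⊤
  /-- `G (i + 1)` is the Weierstrass polynomial of the Puiseux transform
  `T = H(z^t x^q, x^m (y + z^s)) / x^(q m ℓ N)`, where `H` is the Abhyankar shift of `G i`. -/
  weierstrass : ∀ i < k, ∃ (T : (𝕂 (i + 1))⟦X⟧[X]) (U : (𝕂 (i + 1))⟦X⟧⟦X⟧),
    sigmaPull (q i) (m i) (s i) (t i) (z i) (tauPull (shiftCoeff (G i)) (G i)) =
      Polynomial.C (PowerSeries.X ^ ((q i : ℕ) * m i * (P i).natDegree * N i)) * T ∧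
    PowerSeries.IsWeierstrassFactorization (T : (𝕂 (i + 1))⟦X⟧⟦X⟧) (G (i + 1)) U

namespace Run

variable {𝕂 : ℕ → Type*} [∀ i, Field (𝕂 i)] [∀ i, Algebra (𝕂 i) (𝕂 (i + 1))]
  {F : (𝕂 0)⟦X⟧[X]} {k : ℕ}

/-- The polynomial `H_i`: the Abhyankar shift of `G i`. -/
noncomputable def H (R : Run 𝕂 F k) (i : ℕ) : (𝕂 i)⟦X⟧[X] :=
  tauPull (shiftCoeff (R.G i)) (R.G i)

/-- The pull-back `π_i^*`, where `π_0 = τ_0` and `π_{i+1} = π_i ∘ σ_{i+1} ∘ τ_{i+1}`. -/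
noncomputable def pull (R : Run 𝕂 F k) : ∀ i, (𝕂 0)⟦X⟧[X] →+* (𝕂 i)⟦X⟧[X]
  | 0 => tauPull (shiftCoeff (R.G 0))
  | i + 1 => (tauPull (shiftCoeff (R.G (i + 1)))).comp
      ((sigmaPull (R.q i) (R.m i) (R.s i) (R.t i) (R.z i)).comp (R.pull i))

/-- `φ` is the `i`-th minimal polynomial: monic, irreducible and zero at
`(μ_i x^{e_i}, S_i(x)) = π_i(x, 0)`. -/
structure IsMinimalPolynomial (R : Run 𝕂 F k) (i : ℕ) (φ : (𝕂 0)⟦X⟧[X]) : Prop where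
  monic : φ.Monic
  irreducible : Irreducible φ
  eval_eq_zero : (R.pull i φ).eval 0 = 0

end Run

/-! ### The `Φ`-adic expansion -/

/-- The `x`-adic valuation of a polynomial in `y` over `L⟦x⟧`. -/
noncomputable def xVal (G : L⟦X⟧[X]) : ℕ∞ := ⨅ i : ℕ, (G.coeff i).order

/-- The family `(φ_{-1}, φ_0, …, φ_k)` with `φ_{-1} = x`; the entry of index `j` is `φ_{j-1}`. -/
noncomputable def Phi (φ : ℕ → L⟦X⟧[X]) (k : ℕ) : Fin (k + 2) → L⟦X⟧[X] :=
  Fin.cons (Polynomial.C PowerSeries.X) (fun j : Fin (k + 1) => φ j)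

namespace Run

variable {𝕂 : ℕ → Type*} [∀ i, Field (𝕂 i)] [∀ i, Algebra (𝕂 i) (𝕂 (i + 1))]
  {F : (𝕂 0)⟦X⟧[X]} {k : ℕ}

/-- The set of exponents `B = (b_{-1}, …, b_k)` with `b_{i-1} < q_i ℓ_i` for `1 ≤ i ≤ k`; the entry
of index `j` of `B` is `b_{j-1}`. -/
def exponents (R : Run 𝕂 F k) : Set (Fin (k + 2) → ℕ) :=
  {B | ∀ i : Fin k, B i.castSucc.succ < (R.q i : ℕ) * (R.P i).natDegree}

/-- `F = ∑_B f_B Φ^B` is the `Φ`-adic expansion of `F`; the sum may be infinite in `b_{-1}`, the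
exponent of `x`, and converges `x`-adically. -/
structure IsExpansion (R : Run 𝕂 F k) (φ : ℕ → (𝕂 0)⟦X⟧[X])
    (f : (Fin (k + 2) → ℕ) → 𝕂 0) : Prop where
  mem_exponents : ∀ B, f B ≠ 0 → B ∈ R.exponents
  finite : ∀ n : ℕ, {B | f B ≠ 0 ∧ B 0 < n}.Finite
  sum_eq : ∀ n : ℕ, Polynomial.C (PowerSeries.X ^ n) ∣
    F - ∑ B ∈ (finite n).toFinset,
      Polynomial.C (PowerSeries.C (f B)) * ∏ j, Phi φ k j ^ B j

/-- The valuation `v_k(G) = val(π_k^* G)`. -/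
noncomputable def v (R : Run 𝕂 F k) (G : (𝕂 0)⟦X⟧[X]) : ℕ∞ := xVal (R.pull k G)

/-- `⟨B, V⟩`, where `V = (v_k(φ_{-1}), …, v_k(φ_k))`. -/
noncomputable def weight (R : Run 𝕂 F k) (φ : ℕ → (𝕂 0)⟦X⟧[X]) (B : Fin (k + 2) → ℕ) : ℕ∞ :=
  ∑ j, (B j : ℕ∞) * R.v (Phi φ k j)

/-- `w_i = min {⟨B, V⟩ : b_k = i, f_B ≠ 0} - v_k(F)`, with `w_i = ∞` if there is no such `B`. -/
noncomputable def w (R : Run 𝕂 F k) (φ : ℕ → (𝕂 0)⟦X⟧[X]) (f : (Fin (k + 2) → ℕ) → 𝕂 0) (i : ℕ) :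
    WithTop ℤ :=
  WithTop.map (fun n : ℕ => (n : ℤ) - ((R.v F).toNat : ℤ))
    (⨅ B ∈ {B : Fin (k + 2) → ℕ | B (Fin.last (k + 1)) = i ∧ f B ≠ 0}, R.weight φ B)

end Run

end ARNP

namespace ARNP

/-! ### Comparison of lower hulls -/

section Hull

/-! Everything is read off in the coordinates of `π_k`. There `π_k^*F` is `x^{v_k(F)} H_k` times a
unit of `𝕂_k[[x,y]]` (`exists_pull_eq`). For `j < k`, `π_k^*φ_j` is a power of `x` times a unit, and
`π_k^*φ_k` has one extra factor `y` (`Level`). So `π_k^*Φ^B` is `x^⟨B,V⟩ y^{b_k}` times a unit, and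
every monomial of `π_k^*F` is a multiple of some `x^⟨B,V⟩ y^{b_k}` with `f_B ≠ 0`. Conversely, at a
minimal point among the `(b_k, ⟨B,V⟩)`, the coefficient of `π_k^*F` is the sum of `f_B ∏ λ_j^{b_j}`
over the `B` giving that point, with `λ_j` the constant terms of the units. It is nonzero because
these products are linearly independent over `𝕂`. Up to the shift by `v_k(F)`, the two sets of
points thus generate the same upper set. Both lie to the left of `N_k` and contain `(N_k, 0)`, so
their lower hulls agree (`lowerHull_congr`).

Units and independence are proved together by induction on the level (`Level.succ`). On a line `q w
+ m β = n` the Bézout relation turns the sum of initial coefficients into `z^E p(z)`, where `p ≠ 0`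
by independence one level below. If all `β < q ℓ`, then `deg p < ℓ`, so `p(z) ≠ 0`: this is
independence at the next level. Allowing also `β = q ℓ` gives more products than generators of
`𝕂_{i+1}[[x]]` over `𝕂[[x]]`. A linear relation then gives `ψ` vanishing at `π_{i+1}(x,0)`, with
`p(z) = 0` but `p'(z) ≠ 0` by the assumption on the characteristic, so `π_{i+1}^*ψ` is `x^n y` times
a unit (`Level.exists_top`). Since `φ_{i+1}` divides `ψ`, its pull-back has the same shape. -/

theorem exists_le_of_mem_convexHull {S T : Set (ℝ × ℝ)} {N : ℝ}
    (hST : ∀ p ∈ S, ∃ p' ∈ T, p'.1 ≤ p.1 ∧ p'.2 ≤ p.2) (hS : ∀ p ∈ S, p.1 ≤ N)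
    (hT : ∀ p ∈ T, 0 ≤ p.2) (hN : (N, (0 : ℝ)) ∈ T) {p : ℝ × ℝ} (hp : p ∈ convexHull ℝ S) :
    ∃ v ≤ p.2, (p.1, v) ∈ convexHull ℝ T := by
  have hsub : convexHull ℝ S ⊆ {p | p.1 ≤ N ∧ ∃ p' ∈ convexHull ℝ T, p'.1 ≤ p.1 ∧ p'.2 ≤ p.2} := by
    refine convexHull_min (fun p hp => ⟨hS p hp, ?_⟩) ?_
    · obtain ⟨p', h, h'⟩ := hST p hp
      exact ⟨p', subset_convexHull ℝ _ h, h'⟩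
    · rintro p ⟨hp, p', hp', h1, h2⟩ r ⟨hr, r', hr', h3, h4⟩ a b ha hb hab
      refine ⟨?_, a • p' + b • r', convex_convexHull ℝ T hp' hr' ha hb hab, ?_, ?_⟩
      · simp only [Prod.fst_add, Prod.smul_fst, smul_eq_mul]
        calc a * p.1 + b * r.1 ≤ a * N + b * N := by gcongr
          _ = N := by rw [← add_mul, hab, one_mul]
      · simp only [Prod.fst_add, Prod.smul_fst, smul_eq_mul]
        gcongr
      · simp only [Prod.snd_add, Prod.smul_snd, smul_eq_mul]
        gcongr
  obtain ⟨hpN, p', hp', h1, h2⟩ := hsub hp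
  have h0 : 0 ≤ p'.2 := by
    have : convexHull ℝ T ⊆ {p | 0 ≤ p.2} := by
      refine convexHull_min hT ?_
      rintro p hp r hr a b ha hb -
      simp only [Set.mem_ofPred_eq, Prod.snd_add, Prod.smul_snd, smul_eq_mul] at *
      positivity
    exact this hp'
  rcases h1.eq_or_lt with h | h
  · exact ⟨p'.2, h2, by rw [← h]; exact hp'⟩
  -- Slide `p'` along the segment to `(N, 0)` until the abscissa is `p.1`. Since `p'` has
  -- nonnegative ordinate, the height does not increase.
  · have hlt : 0 < N - p'.1 := by linarith
    set b := (p.1 - p'.1) / (N - p'.1) with hb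
    have hb0 : 0 ≤ b := div_nonneg (by linarith) hlt.le
    have hb1 : b ≤ 1 := (div_le_one hlt).2 (by linarith)
    refine ⟨(1 - b) * p'.2, by nlinarith, ?_⟩
    have := convex_convexHull ℝ T hp' (subset_convexHull ℝ T hN) (sub_nonneg.2 hb1) hb0 (by ring)
    convert this using 1
    refine Prod.ext ?_ ?_
    · simp only [Prod.fst_add, Prod.smul_fst, smul_eq_mul]
      have : b * (N - p'.1) = p.1 - p'.1 := div_mul_cancel₀ _ hlt.ne'
      linarith
    · simp

theorem lowerHull_subset {S T : Set (ℝ × ℝ)}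
    (hST : ∀ p ∈ convexHull ℝ S, ∃ v ≤ p.2, (p.1, v) ∈ convexHull ℝ T)
    (hTS : ∀ p ∈ convexHull ℝ T, ∃ v ≤ p.2, (p.1, v) ∈ convexHull ℝ S) :
    lowerHull S ⊆ lowerHull T := by
  rintro p ⟨hp, hmin⟩
  obtain ⟨v, hv, hvT⟩ := hST p hp
  obtain ⟨u, hu, huS⟩ := hTS _ hvT
  have hpv : v = p.2 := le_antisymm hv ((hmin u huS).trans hu)
  refine ⟨by rw [hpv] at hvT; exact hvT, fun w hw => ?_⟩
  obtain ⟨u', hu', hu'S⟩ := hTS _ hw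
  exact (hmin u' hu'S).trans hu'

/-- Two sets of points that generate the same upper set for the product order, lie on the left of
`(N, 0)` and contain it, have the same lower hull. -/
theorem lowerHull_congr {S T : Set (ℝ × ℝ)} {N : ℝ}
    (hST : ∀ p ∈ S, ∃ p' ∈ T, p'.1 ≤ p.1 ∧ p'.2 ≤ p.2)
    (hTS : ∀ p ∈ T, ∃ p' ∈ S, p'.1 ≤ p.1 ∧ p'.2 ≤ p.2)
    (hS : ∀ p ∈ S, p.1 ≤ N) (hT : ∀ p ∈ T, p.1 ≤ N) (hS0 : ∀ p ∈ S, 0 ≤ p.2)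
    (hNS : (N, (0 : ℝ)) ∈ S) (hNT : (N, (0 : ℝ)) ∈ T) : lowerHull S = lowerHull T := by
  have hT0 : ∀ p ∈ T, 0 ≤ p.2 := fun p hp => by
    obtain ⟨p', hp', -, h⟩ := hTS p hp
    exact (hS0 p' hp').trans h
  have h1 := fun p (hp : p ∈ convexHull ℝ S) => exists_le_of_mem_convexHull hST hS hT0 hNT hp
  have h2 := fun p (hp : p ∈ convexHull ℝ T) => exists_le_of_mem_convexHull hTS hT hS0 hNS hp
  exact (lowerHull_subset h1 h2).antisymm (lowerHull_subset h2 h1)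

end Hull

/-! ### Reduction modulo `x` and initial forms -/

section Init

variable {L : Type*} [Field L]

/-- Reduction modulo `x`. -/
noncomputable def red : L⟦X⟧[X] →+* L[X] := Polynomial.mapRingHom PowerSeries.constantCoeff

/-- The constant coefficient in `x` and `y`. -/
noncomputable def cc : L⟦X⟧[X] →+* L := Polynomial.constantCoeff.comp red

@[simp] theorem red_C (a : L⟦X⟧) :
    red (Polynomial.C a) = Polynomial.C (PowerSeries.constantCoeff a) := by
  simp [red]

@[simp] theorem red_X : red (Polynomial.X : L⟦X⟧[X]) = Polynomial.X := by
  simp [red]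

theorem coeff_red (f : L⟦X⟧[X]) (i : ℕ) :
    (red f).coeff i = PowerSeries.constantCoeff (f.coeff i) := by
  simp [red]

theorem cc_apply (f : L⟦X⟧[X]) : cc f = PowerSeries.constantCoeff (f.coeff 0) := by
  simp [cc, Polynomial.constantCoeff_apply, coeff_red]

theorem cc_eq (f : L⟦X⟧[X]) : cc f = (red f).coeff 0 := by
  simp [cc, Polynomial.constantCoeff_apply]

/-- `f = xⁿ (p + O(x))`. -/
def HasInit (f : L⟦X⟧[X]) (n : ℕ) (p : L[X]) : Prop :=
  ∃ g, f = Polynomial.C (PowerSeries.X ^ n) * g ∧ red g = p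

theorem HasInit.mul {f g : L⟦X⟧[X]} {n m : ℕ} {p r : L[X]} (hf : HasInit f n p)
    (hg : HasInit g m r) : HasInit (f * g) (n + m) (p * r) := by
  obtain ⟨f', rfl, rfl⟩ := hf
  obtain ⟨g', rfl, rfl⟩ := hg
  exact ⟨f' * g', by rw [pow_add, map_mul]; ring, map_mul _ _ _⟩

theorem HasInit.one : HasInit (1 : L⟦X⟧[X]) 0 1 := ⟨1, by simp, map_one _⟩

theorem HasInit.pow {f : L⟦X⟧[X]} {n : ℕ} {p : L[X]} (hf : HasInit f n p) (b : ℕ) :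
    HasInit (f ^ b) (b * n) (p ^ b) := by
  induction b with
  | zero => simpa using HasInit.one
  | succ b ih => rw [pow_succ, pow_succ, Nat.succ_mul]; exact ih.mul hf

theorem HasInit.prod {ι : Type*} {s : Finset ι} {f : ι → L⟦X⟧[X]} {n : ι → ℕ} {p : ι → L[X]}
    (h : ∀ i ∈ s, HasInit (f i) (n i) (p i)) :
    HasInit (∏ i ∈ s, f i) (∑ i ∈ s, n i) (∏ i ∈ s, p i) := by
  classical
  induction s using Finset.induction_on with
  | empty => simpa using HasInit.one
  | insert a s ha ih =>
    rw [Finset.prod_insert ha, Finset.sum_insert ha, Finset.prod_insert ha]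
    exact (h a (by simp)).mul (ih fun i hi => h i (by simp [hi]))

/-- Only the terms of order exactly `n₀` survive modulo `x` after division by `x^n₀`. The resulting
initial form may be zero. -/
theorem HasInit.sum {ι : Type*} {s : Finset ι} {f : ι → L⟦X⟧[X]} {n : ι → ℕ} {p : ι → L[X]}
    {n₀ : ℕ} (h : ∀ i ∈ s, HasInit (f i) (n i) (p i)) (hn : ∀ i ∈ s, n₀ ≤ n i) :
    HasInit (∑ i ∈ s, f i) n₀ (∑ i ∈ s with n i = n₀, p i) := by
  classical
  have : ∀ i ∈ s, HasInit (f i) n₀ (if n i = n₀ then p i else 0) := by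
    intro i hi
    obtain ⟨g, hg, hr⟩ := h i hi
    obtain ⟨c, hc⟩ := Nat.exists_eq_add_of_le (hn i hi)
    refine ⟨Polynomial.C (PowerSeries.X ^ c) * g, by rw [hg, hc, pow_add, map_mul]; ring, ?_⟩
    split_ifs with h0
    · have : c = 0 := by omega
      simp [this, hr]
    · have : c ≠ 0 := by omega
      simp [this]
  choose! g hg using this
  refine ⟨∑ i ∈ s, g i, ?_, ?_⟩
  · rw [Finset.mul_sum]
    exact Finset.sum_congr rfl fun i hi => (hg i hi).1
  · rw [map_sum, Finset.sum_filter]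
    exact Finset.sum_congr rfl fun i hi => (hg i hi).2

theorem C_X_pow_ne_zero (n : ℕ) : Polynomial.C (PowerSeries.X ^ n : L⟦X⟧) ≠ 0 :=
  Polynomial.C_ne_zero.2 (pow_ne_zero _ PowerSeries.X_ne_zero)

theorem exists_eq_C_X_pow_mul {f : L⟦X⟧[X]} (hf : f ≠ 0) :
    ∃ n g, f = Polynomial.C (PowerSeries.X ^ n) * g ∧ red g ≠ 0 := by
  obtain ⟨i, hi⟩ : ∃ i, f.coeff i ≠ 0 := by
    by_contra! h
    exact hf (Polynomial.ext (by simpa using h))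
  obtain ⟨j, hj⟩ : ∃ j, PowerSeries.coeff j (f.coeff i) ≠ 0 := by
    by_contra! h
    exact hi (PowerSeries.ext (by simpa using h))
  have hex : ∃ j, ∃ i, PowerSeries.coeff j (f.coeff i) ≠ 0 := ⟨j, i, hj⟩
  obtain ⟨n, ⟨i, hi⟩, hmin⟩ : ∃ n, (∃ i, PowerSeries.coeff n (f.coeff i) ≠ 0) ∧
      ∀ m < n, ∀ i, PowerSeries.coeff m (f.coeff i) = 0 := by
    classical
    refine ⟨Nat.find hex, Nat.find_spec hex, fun m hm => ?_⟩
    have := Nat.find_min hex hm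
    push Not at this
    exact this
  have hdvd : Polynomial.C (PowerSeries.X ^ n) ∣ f := by
    rw [Polynomial.C_dvd_iff_dvd_coeff]
    exact fun i => PowerSeries.X_pow_dvd_iff.2 fun m hm => hmin m hm i
  obtain ⟨g, rfl⟩ := hdvd
  refine ⟨n, g, rfl, fun h => hi ?_⟩
  have : (red g).coeff i = 0 := by rw [h, Polynomial.coeff_zero]
  rw [coeff_red] at this
  rw [Polynomial.coeff_C_mul, PowerSeries.coeff_X_pow_mul', if_pos le_rfl, Nat.sub_self]
  simpa using this

theorem xVal_C_X_pow_mul {n : ℕ} {g : L⟦X⟧[X]} (hg : red g ≠ 0) :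
    xVal (Polynomial.C (PowerSeries.X ^ n) * g) = n := by
  refine le_antisymm ?_ ?_
  · obtain ⟨i, hi⟩ : ∃ i, (red g).coeff i ≠ 0 := by
      by_contra! h
      exact hg (Polynomial.ext (by simpa using h))
    refine (iInf_le _ i).trans ?_
    apply PowerSeries.order_le
    rw [Polynomial.coeff_C_mul, PowerSeries.coeff_X_pow_mul', if_pos le_rfl, Nat.sub_self]
    simpa [coeff_red] using hi
  · refine le_iInf fun i => ?_
    rw [Polynomial.coeff_C_mul]
    refine PowerSeries.nat_le_order _ _ fun j hj => ?_
    rw [PowerSeries.coeff_X_pow_mul', if_neg (by omega)]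

/-- Cancellation in a product `xⁿ · unit`. -/
theorem eq_X_pow_mul_of_mul_eq {A B U : L⟦X⟧[X]} {N : ℕ}
    (h : A * B = Polynomial.C (PowerSeries.X ^ N) * U) (hU : cc U ≠ 0) :
    ∃ a A', A = Polynomial.C (PowerSeries.X ^ a) * A' ∧ cc A' ≠ 0 := by
  have hU0 : red U ≠ 0 := fun h0 => hU (by rw [cc_eq, h0, Polynomial.coeff_zero])
  have hne : A * B ≠ 0 := by
    rw [h]
    exact mul_ne_zero (C_X_pow_ne_zero N) fun h0 => hU0 (by rw [h0, map_zero])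
  obtain ⟨a, A', rfl, hA⟩ := exists_eq_C_X_pow_mul (left_ne_zero_of_mul hne)
  obtain ⟨b, B', rfl, hB⟩ := exists_eq_C_X_pow_mul (right_ne_zero_of_mul hne)
  have h1 : Polynomial.C (PowerSeries.X ^ (a + b)) * (A' * B') =
      Polynomial.C (PowerSeries.X ^ N) * U := by
    rw [← h, pow_add, map_mul]; ring
  -- Reductions modulo `x` lie in a domain, so the `x`-adic valuation is additive.
  have hN : a + b = N := by
    have := congrArg xVal h1
    rw [xVal_C_X_pow_mul hU0, xVal_C_X_pow_mul (by rw [map_mul]; exact mul_ne_zero hA hB)] at this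
    exact_mod_cast this
  rw [hN] at h1
  have h2 := mul_left_cancel₀ (C_X_pow_ne_zero N) h1
  refine ⟨a, A', rfl, fun h0 => hU ?_⟩
  rw [← h2, map_mul, h0, zero_mul]

end Init

/-! ### The pull-backs -/

section Pull

variable {L M : Type*} [Field L] [Field M] [Algebra L M]

@[simp] theorem tauPull_C (c a : L⟦X⟧) : tauPull c (Polynomial.C a) = Polynomial.C a := by
  simp [tauPull]

@[simp] theorem tauPull_X (c : L⟦X⟧) :
    tauPull c Polynomial.X = Polynomial.X + Polynomial.C c := by
  simp [tauPull]

theorem red_tauPull {c : L⟦X⟧} (hc : PowerSeries.constantCoeff c = 0) (f : L⟦X⟧[X]) :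
    red (tauPull c f) = red f := by
  simp [red, tauPull, Polynomial.map_comp, hc]

theorem cc_tauPull {c : L⟦X⟧} (hc : PowerSeries.constantCoeff c = 0) (f : L⟦X⟧[X]) :
    cc (tauPull c f) = cc f := by
  rw [cc_eq, red_tauPull hc, ← cc_eq]

theorem HasInit.tauPull {f : L⟦X⟧[X]} {n : ℕ} {p : L[X]} (h : HasInit f n p) {c : L⟦X⟧}
    (hc : PowerSeries.constantCoeff c = 0) : HasInit (tauPull c f) n p := by
  obtain ⟨g, rfl, rfl⟩ := h
  exact ⟨ARNP.tauPull c g, by rw [map_mul, tauPull_C], red_tauPull hc g⟩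

theorem natDegree_tauPull (c : L⟦X⟧) (f : L⟦X⟧[X]) : (tauPull c f).natDegree = f.natDegree := by
  simp [tauPull, Polynomial.natDegree_comp]

theorem monic_tauPull (c : L⟦X⟧) {f : L⟦X⟧[X]} (hf : f.Monic) : (tauPull c f).Monic := by
  simpa [tauPull] using hf.comp_X_add_C c

@[simp] theorem xPull_X (q : ℕ+) (u : M) :
    xPull (L := L) q u PowerSeries.X = PowerSeries.C u * PowerSeries.X ^ (q : ℕ) := by
  simp [xPull, PowerSeries.rescale_X, PowerSeries.expand_C]

theorem coeff_xPull (q : ℕ+) (u : M) (a : L⟦X⟧) (n : ℕ) :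
    PowerSeries.coeff n (xPull q u a) = if (q : ℕ) ∣ n then
      u ^ (n / q) * algebraMap L M (PowerSeries.coeff (n / q) a) else 0 := by
  simp [xPull, PowerSeries.coeff_expand, PowerSeries.coeff_rescale]

theorem xPull_C (q : ℕ+) (u : M) (a : L) :
    xPull q u (PowerSeries.C a) = PowerSeries.C (algebraMap L M a) := by
  ext n
  rw [coeff_xPull, PowerSeries.coeff_C, PowerSeries.coeff_C]
  rcases Nat.eq_zero_or_pos n with rfl | hn
  · simp
  · rw [if_neg hn.ne']
    split_ifs with h1 h2
    · exact absurd h2 (Nat.div_pos (Nat.le_of_dvd hn h1) q.pos).ne'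
    · simp
    · rfl

theorem constantCoeff_xPull (q : ℕ+) (u : M) (a : L⟦X⟧) :
    PowerSeries.constantCoeff (xPull q u a) = algebraMap L M (PowerSeries.constantCoeff a) := by
  rw [← PowerSeries.coeff_zero_eq_constantCoeff_apply, coeff_xPull]
  simp

@[simp] theorem sigmaPull_C (q : ℕ+) (m s t : ℕ) (z : M) (a : L⟦X⟧) :
    sigmaPull q m s t z (Polynomial.C a) = Polynomial.C (xPull q (z ^ t) a) := by
  simp [sigmaPull]

@[simp] theorem sigmaPull_X (q : ℕ+) (m s t : ℕ) (z : M) :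
    sigmaPull (L := L) q m s t z Polynomial.X = Polynomial.C (PowerSeries.X ^ m) *
      (Polynomial.X + Polynomial.C (PowerSeries.C (z ^ s))) := by
  simp [sigmaPull]

theorem sigmaPull_C_X_pow (q : ℕ+) (m s t : ℕ) (z : M) (n : ℕ) :
    sigmaPull (L := L) q m s t z (Polynomial.C (PowerSeries.X ^ n)) =
      Polynomial.C (PowerSeries.X ^ ((q : ℕ) * n)) *
        Polynomial.C (PowerSeries.C (z ^ (t * n))) := by
  rw [sigmaPull_C, ← map_mul, map_pow, xPull_X, mul_pow, ← pow_mul, ← map_pow, ← pow_mul, mul_comm]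

/-- When `m > 0`, `σ^*y` is divisible by `x`, so only the constant term survives. When `m = 0`,
possible only in the first iteration, the lemma is needed for `f = 1` alone. -/
theorem red_sigmaPull {q : ℕ+} {m s t : ℕ} {z : M} {f : L⟦X⟧[X]} (h : 0 < m ∨ f = 1) :
    red (sigmaPull q m s t z f) = Polynomial.C (algebraMap L M (cc f)) := by
  rcases h with h | rfl
  · conv_lhs => rw [← Polynomial.X_mul_divX_add f]
    rw [map_add, map_mul, sigmaPull_X, sigmaPull_C]
    simp [h.ne', constantCoeff_xPull, cc_apply]
  · simp

theorem natDegree_sigmaPull_le (q : ℕ+) (m s t : ℕ) (z : M) (f : L⟦X⟧[X]) :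
    (sigmaPull q m s t z f).natDegree ≤ f.natDegree := by
  rw [sigmaPull, Polynomial.coe_eval₂RingHom, Polynomial.eval₂_eq_sum_range]
  refine Polynomial.natDegree_sum_le_of_forall_le _ _ fun i hi => ?_
  have h1 : (Polynomial.C (PowerSeries.X ^ m) *
      (Polynomial.X + Polynomial.C (PowerSeries.C (z ^ s))) : M⟦X⟧[X]).natDegree ≤ 1 :=
    (Polynomial.natDegree_C_mul_le _ _).trans (Polynomial.natDegree_X_add_C _).le
  refine (Polynomial.natDegree_C_mul_le _ _).trans (Polynomial.natDegree_pow_le.trans ?_)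
  have : i ≤ f.natDegree := by simpa [Nat.lt_succ_iff] using hi
  nlinarith

end Pull

/-! ### Edge data -/

section Edge

variable {L : Type*} [Field L] {H : L⟦X⟧[X]} {q m : ℕ} {P : L[X]} {N : ℕ}

theorem IsEdgeData.degree_le (h : IsEdgeData H q m P N) : q * P.natDegree * N ≤ H.natDegree := by
  have hmem : (((q * P.natDegree * N : ℕ) : ℝ), (0 : ℝ)) ∈ newtonPolygon H := by
    rw [h.straight]; exact right_mem_segment ..
  have hsub : convexHull ℝ (points (fun i => WithTop.map (fun n : ℕ => (n : ℤ)) (H.coeff i).order)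
      H.natDegree) ⊆ {p | p.1 ≤ (H.natDegree : ℝ)} := by
    refine convexHull_min ?_ ?_
    · rintro p ⟨i, hi, v, -, rfl⟩
      show (i : ℝ) ≤ _
      exact_mod_cast hi
    · intro p hp r hr a b ha hb hab
      simp only [Set.mem_ofPred_eq, Prod.fst_add, Prod.smul_fst, smul_eq_mul] at *
      calc a * p.1 + b * r.1 ≤ a * H.natDegree + b * H.natDegree := by gcongr
        _ = H.natDegree := by rw [← add_mul, hab, one_mul]
  have h1 : ((q * P.natDegree * N : ℕ) : ℝ) ≤ (H.natDegree : ℝ) := hsub hmem.1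
  exact_mod_cast h1

/-- The only generator of the hull with abscissa `0` is `(0, val a₀)`, so it is the left end of the
edge. Its coefficient in the boundary polynomial is nonzero, whereas `P(0) = 0` would make that
polynomial vanish at `y = 0`. -/
theorem IsEdgeData.coeff_zero_ne_zero_and_order (h : IsEdgeData H q m P N) :
    P.coeff 0 ≠ 0 ∧ (H.coeff 0).order = (m * P.natDegree * N : ℕ) := by
  have hmem : ((0 : ℝ), ((m * P.natDegree * N : ℕ) : ℝ)) ∈ newtonPolygon H := by
    rw [h.straight]; exact left_mem_segment ..
  have hsub : convexHull ℝ (points (fun i => WithTop.map (fun n : ℕ => (n : ℤ)) (H.coeff i).order)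
      H.natDegree) ⊆ {p | 0 ≤ p.1 ∧ (p.1 = 0 → ∃ v : ℕ, (H.coeff 0).order = v ∧ p.2 = v)} := by
    refine convexHull_min ?_ ?_
    · rintro p ⟨i, hi, v, hv, rfl⟩
      refine ⟨Nat.cast_nonneg i, fun h0 => ?_⟩
      obtain rfl : i = 0 := Nat.cast_eq_zero.1 (show (i : ℝ) = 0 from h0)
      obtain ⟨n, hn, hn'⟩ := WithTop.map_eq_some_iff.1 hv
      exact ⟨n, hn, by simp [← hn']⟩
    · rintro p ⟨hp, hp'⟩ r ⟨hr, hr'⟩ a b ha hb hab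
      simp only [Prod.fst_add, Prod.smul_fst, smul_eq_mul, Prod.snd_add,
        Prod.smul_snd, Set.mem_ofPred_eq]
      refine ⟨by positivity, fun h0 => ?_⟩
      obtain ⟨h1, h2⟩ := (add_eq_zero_iff_of_nonneg (by positivity) (by positivity)).1 h0
      rcases ha.eq_or_lt with rfl | ha
      · obtain rfl : b = 1 := by linarith
        simpa using hr' (by simpa using h2)
      rcases hb.eq_or_lt with rfl | hb
      · obtain rfl : a = 1 := by linarith
        simpa using hp' (by simpa using h1)
      obtain ⟨v, hv, hv'⟩ := hp' (by simpa [ha.ne'] using h1)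
      obtain ⟨w, hw, hw'⟩ := hr' (by simpa [hb.ne'] using h2)
      obtain rfl : v = w := by exact_mod_cast hv.symm.trans hw
      exact ⟨v, hv, by rw [hv', hw', ← add_mul, hab, one_mul]⟩
  obtain ⟨-, h2⟩ := hsub hmem.1
  obtain ⟨v, hv, hv'⟩ := h2 rfl
  obtain rfl : m * P.natDegree * N = v :=
    Nat.cast_injective (show ((m * P.natDegree * N : ℕ) : ℝ) = v from hv')
  refine ⟨fun hP => ?_, hv⟩
  obtain ⟨c, hc, hb⟩ := h.boundary
  have h3 := congrArg (fun f => Polynomial.eval 0 f) hb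
  have h4 : (quasiHom P q m).eval 0 = 0 := by
    rw [quasiHom, Polynomial.eval_finsetSum]
    refine Finset.sum_eq_zero fun j _ => ?_
    rw [Polynomial.eval_monomial]
    rcases Nat.eq_zero_or_pos j with rfl | hj
    · simp [hP]
    · rw [zero_pow (Nat.mul_pos h.q_pos hj).ne', mul_zero]
  rw [Polynomial.eval_mul, Polynomial.eval_pow, h4, zero_pow h.N_pos.ne', mul_zero,
    ← Polynomial.coeff_zero_eq_eval_zero, boundaryPoly, Polynomial.finsetSum_coeff,
    Finset.sum_eq_single 0 (fun i _ hi => by rw [Polynomial.coeff_monomial, if_neg hi])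
      (fun h => by simp at h), Polynomial.coeff_monomial_same] at h3
  have h5 := congrArg (PowerSeries.coeff (m * P.natDegree * N)) h3
  rw [PowerSeries.coeff_mk, if_pos (by exact_mod_cast hmem), map_zero] at h5
  exact PowerSeries.order_eq_nat.1 hv |>.1 h5

end Edge

/-! ### Weierstrass factorizations of polynomials -/

section Weierstrass

variable {L : Type*} [Field L]

theorem red_of_isDistinguishedAt {G : L⟦X⟧[X]}
    (hG : G.IsDistinguishedAt (IsLocalRing.maximalIdeal L⟦X⟧)) :
    red G = Polynomial.X ^ G.natDegree := by
  ext i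
  rw [coeff_red, Polynomial.coeff_X_pow]
  rcases lt_trichotomy i G.natDegree with h | rfl | h
  · rw [if_neg h.ne]
    have := hG.mem h
    rw [IsLocalRing.mem_maximalIdeal, mem_nonunits_iff, PowerSeries.isUnit_iff_constantCoeff,
      isUnit_iff_ne_zero, not_not] at this
    exact this
  · rw [if_pos rfl, hG.monic.coeff_natDegree, map_one]
  · rw [if_neg h.ne', Polynomial.coeff_eq_zero_of_natDegree_lt h, map_zero]

/-- Euclidean division of `T` by the monic `G` is also a Weierstrass division. By uniqueness the
remainder is zero and the unit `U` is the polynomial quotient. -/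
theorem exists_polynomial_of_isWeierstrassFactorization {T G : L⟦X⟧[X]} {U : L⟦X⟧⟦X⟧}
    (h : PowerSeries.IsWeierstrassFactorization (T : L⟦X⟧⟦X⟧) G U) :
    ∃ Q : L⟦X⟧[X], T = G * Q ∧ cc Q ≠ 0 := by
  have hG := h.isDistinguishedAt
  have hdiv : (G : L⟦X⟧⟦X⟧) * U + ((0 : L⟦X⟧[X]) : L⟦X⟧⟦X⟧) =
      G * ((T /ₘ G : L⟦X⟧[X]) : L⟦X⟧⟦X⟧) + ((T %ₘ G : L⟦X⟧[X]) : L⟦X⟧⟦X⟧) := by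
    rw [Polynomial.coe_zero, add_zero, ← h.eq_mul, ← Polynomial.coe_mul, ← Polynomial.coe_add,
      add_comm, Polynomial.modByMonic_add_div]
  have hdeg : ((PowerSeries.map (Ideal.Quotient.mk (IsLocalRing.maximalIdeal L⟦X⟧))
      (G : L⟦X⟧⟦X⟧)).order.toNat : WithBot ℕ) = G.degree := by
    rw [Polynomial.degree_eq_natDegree hG.monic.ne_zero,
      show G.natDegree = _ from congr(ENat.toNat $(hG.coe_natDegree_eq_order_map G 1
        (by rw [PowerSeries.constantCoeff_one, ← Ideal.ne_top_iff_one]; exact Ideal.IsPrime.ne_top')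
        (by simp)))]
  obtain ⟨hU, h0⟩ := hG.isWeierstrassDivisorAt'.eq_of_mul_add_eq_mul_add
    (by rw [Polynomial.degree_zero]; exact bot_lt_iff_ne_bot.2 (by simp))
    (by rw [hdeg]; exact Polynomial.degree_modByMonic_lt _ hG.monic) hdiv
  refine ⟨T /ₘ G, ?_, ?_⟩
  · conv_lhs => rw [← Polynomial.modByMonic_add_div T G, ← h0, zero_add]
  · have hu := h.isUnit
    rw [hU, PowerSeries.isUnit_iff_constantCoeff, PowerSeries.isUnit_iff_constantCoeff,
      isUnit_iff_ne_zero] at hu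
    rw [cc_apply]
    simpa using hu

theorem natDegree_le_of_isWeierstrassFactorization {T G : L⟦X⟧[X]} {U : L⟦X⟧⟦X⟧}
    (h : PowerSeries.IsWeierstrassFactorization (T : L⟦X⟧⟦X⟧) G U) : G.natDegree ≤ T.natDegree := by
  obtain ⟨Q, rfl, hQ⟩ := exists_polynomial_of_isWeierstrassFactorization h
  have : Q ≠ 0 := fun h0 => hQ (by rw [h0, map_zero])
  rw [h.isDistinguishedAt.monic.natDegree_mul' this]
  exact Nat.le_add_right _ _

theorem constantCoeff_shiftCoeff {G : L⟦X⟧[X]}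
    (hG : G.IsDistinguishedAt (IsLocalRing.maximalIdeal L⟦X⟧)) :
    PowerSeries.constantCoeff (shiftCoeff G) = 0 := by
  rcases Nat.eq_zero_or_pos G.natDegree with h | h
  -- In degree `0` the shift is zero, because the inverse of `0` is `0`.
  · simp [shiftCoeff, h]
  · have : PowerSeries.constantCoeff (G.coeff (G.natDegree - 1)) = 0 := by
      rw [← coeff_red, red_of_isDistinguishedAt hG, Polynomial.coeff_X_pow, if_neg (by omega)]
    simp [shiftCoeff, this]

end Weierstrass

/-! ### Linear algebra -/

section Spans

variable {A B C : Type*} [CommRing A] [CommRing B] [CommRing C]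

/-- `B` is generated by `n` elements as a module over `A`. -/
def SpannedBy (ι : A →+* B) (n : ℕ) : Prop :=
  ∃ v : Fin n → B, ∀ b, ∃ a : Fin n → A, b = ∑ i, ι (a i) * v i

theorem SpannedBy.comp {ι : A →+* B} {κ : B →+* C} {n m : ℕ} (h : SpannedBy ι n)
    (h' : SpannedBy κ m) : SpannedBy (κ.comp ι) (n * m) := by
  obtain ⟨v, hv⟩ := h
  obtain ⟨w, hw⟩ := h'
  refine ⟨fun i => κ (v (finProdFinEquiv.symm i).1) * w (finProdFinEquiv.symm i).2, fun c => ?_⟩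
  obtain ⟨b, rfl⟩ := hw c
  choose a ha using fun j => hv (b j)
  refine ⟨fun i => a (finProdFinEquiv.symm i).2 (finProdFinEquiv.symm i).1, ?_⟩
  rw [finProdFinEquiv.symm.sum_comp
    (fun p : Fin n × Fin m => (κ.comp ι) (a p.2 p.1) * (κ (v p.1) * w p.2)),
    Fintype.sum_prod_type_right]
  refine Finset.sum_congr rfl fun j _ => ?_
  rw [ha j, map_sum, Finset.sum_mul]
  refine Finset.sum_congr rfl fun i _ => ?_
  rw [map_mul, RingHom.comp_apply, mul_assoc]

theorem SpannedBy.exists_relation [IsDomain A] {ι : A →+* B} {n : ℕ} (h : SpannedBy ι n)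
    {I : Type*} [Fintype I] (hI : n < Fintype.card I) (w : I → B) :
    ∃ a : I → A, a ≠ 0 ∧ ∑ i, ι (a i) * w i = 0 := by
  obtain ⟨v, hv⟩ := h
  let := ι.toAlgebra
  classical
  by_contra! hcon
  have hli : LinearIndependent A w := by
    rw [Fintype.linearIndependent_iff]
    intro g hg
    by_contra! hne
    exact hcon g (fun h0 => by obtain ⟨i, hi⟩ := hne; exact hi (congrFun h0 i)) (by
      simpa [Algebra.smul_def, RingHom.algebraMap_toAlgebra] using hg)
  have hspan : Submodule.span A (Set.range v) = ⊤ := by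
    rw [eq_top_iff]
    rintro b -
    obtain ⟨a, rfl⟩ := hv b
    refine Submodule.sum_mem _ fun i _ => ?_
    rw [← RingHom.algebraMap_toAlgebra ι, ← Algebra.smul_def]
    exact Submodule.smul_mem _ _ (Submodule.subset_span ⟨i, rfl⟩)
  have := linearIndependent_le_span w hli (Set.range v) hspan
  have h2 : Fintype.card (Set.range v) ≤ n := by
    simpa using Fintype.card_range_le v
  rw [Cardinal.mk_fintype] at this
  have h3 : Fintype.card I ≤ Fintype.card (Set.range v) := by exact_mod_cast this
  omega

end Spans

/-! ### Simple extensions -/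

section Field

variable {L M : Type*} [Field L] [Field M] [Algebra L M] {P : L[X]} {z : M}

theorem minpoly_eq (hP : Irreducible P) (hm : P.Monic) (hz : Polynomial.aeval z P = 0) :
    minpoly L z = P := (minpoly.eq_of_irreducible_of_monic hP hz hm).symm

theorem aeval_ne_zero (hP : Irreducible P) (hm : P.Monic) (hz : Polynomial.aeval z P = 0)
    {p : L[X]} (hp : p ≠ 0) (hdeg : p.natDegree < P.natDegree) : Polynomial.aeval z p ≠ 0 := by
  intro h
  have h1 := minpoly.dvd L z h
  rw [minpoly_eq hP hm hz] at h1
  exact absurd (Polynomial.natDegree_le_of_dvd h1 hp) (by omega)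

theorem root_ne_zero (hP : P.coeff 0 ≠ 0) (hz : Polynomial.aeval z P = 0) : z ≠ 0 := by
  rintro rfl
  rw [← Polynomial.coeff_zero_eq_aeval_zero'] at hz
  exact hP ((map_eq_zero _).1 hz)

/-- A nonzero `p` of degree at most `deg P` vanishing at `z` has degree exactly `deg P`. Its
derivative is then nonzero, as `deg P` is invertible in `L`, and has too small a degree to vanish at
`z`. -/
theorem aeval_derivative_ne_zero (hP : Irreducible P) (hm : P.Monic)
    (hz : Polynomial.aeval z P = 0) {p : L[X]} (hp : p ≠ 0) (hdeg : p.natDegree ≤ P.natDegree)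
    (hpz : Polynomial.aeval z p = 0) (hchar : (P.natDegree : L) ≠ 0) :
    Polynomial.aeval z p.derivative ≠ 0 := by
  have hpos := hP.natDegree_pos
  have hd : p.natDegree = P.natDegree := by
    by_contra h
    exact aeval_ne_zero hP hm hz hp (by omega) hpz
  refine aeval_ne_zero hP hm hz (fun h0 => ?_)
    (by have := Polynomial.natDegree_derivative_lt (p := p) (by omega); omega)
  have := congrArg (fun r => Polynomial.coeff r (P.natDegree - 1)) h0
  simp only [Polynomial.coeff_derivative, Polynomial.coeff_zero] at this
  rw [Nat.sub_add_cancel hpos, ← hd, Polynomial.coeff_natDegree] at this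
  rcases mul_eq_zero.1 this with h | h
  · exact hp (Polynomial.leadingCoeff_eq_zero.1 h)
  · apply hchar
    have h2 : ((P.natDegree - 1 + 1 : ℕ) : L) = 0 := by rw [hd] at h; exact_mod_cast h
    rwa [Nat.sub_add_cancel hpos] at h2

/-- The terms `(β, w)` on a line `q w + m β = n` evaluate at `y = 0` to the value at `z` of a
polynomial in one variable. -/
theorem exists_edge_polynomial {ι : Type*} {S : Finset ι} (hS : S.Nonempty) {β w : ι → ℕ}
    {c : ι → L} {q m s t n : ℕ} (hq : 0 < q) (hst : q * s = m * t + 1)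
    (hline : ∀ b ∈ S, q * w b + m * β b = n)
    (hc : ∀ b₀ ∈ S, ∑ b ∈ S with β b = β b₀, c b ≠ 0) (z : M) :
    ∃ (p : L[X]) (E b₀ : ℕ), p ≠ 0 ∧ (∃ b ∈ S, p.natDegree ≤ β b / q) ∧
      ∑ b ∈ S, algebraMap L M (c b) * z ^ (t * w b + s * β b) = z ^ E * Polynomial.aeval z p ∧
      ∑ b ∈ S, algebraMap L M (c b) * β b * z ^ (t * w b + s * β b) =
        z ^ E * (b₀ * Polynomial.aeval z p + q * z * Polynomial.aeval z p.derivative) := by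
  obtain ⟨a, ha⟩ := hS
  -- By Bézout the exponent of `z`, multiplied by `q`, is `t n + β`. Hence all `β` share one residue
  -- modulo `q`, and the exponent is a constant plus `β / q`.
  have hE : ∀ b ∈ S, q * (t * w b + s * β b) = t * n + β b := fun b hb => by
    calc q * (t * w b + s * β b) = t * (q * w b) + (q * s) * β b := by ring
      _ = t * (q * w b + m * β b) + β b := by rw [hst]; ring
      _ = _ := by rw [hline b hb]
  have hmod : ∀ b ∈ S, β b % q = β a % q := fun b hb => by
    have h1 : (t * n + β b) ≡ (t * n + β a) [MOD q] := by
      rw [← hE b hb, ← hE a ha]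
      exact ((Nat.modEq_zero_iff_dvd.2 (dvd_mul_right _ _))).trans
        (Nat.modEq_zero_iff_dvd.2 (dvd_mul_right _ _)).symm
    exact Nat.ModEq.add_left_cancel' _ h1
  have hdiv : ∀ b ∈ S, β b = β a % q + q * (β b / q) := fun b hb => by
    rw [← hmod b hb, Nat.mod_add_div]
  have hle : ∀ b ∈ S, q * (t * w b + s * β b) = t * n + β a % q + q * (β b / q) := fun b hb => by
    rw [hE b hb]; have := hdiv b hb; omega
  obtain ⟨E, hEa⟩ : q ∣ t * n + β a % q :=
    (Nat.dvd_add_left (dvd_mul_right q (β a / q))).1 (hle a ha ▸ dvd_mul_right _ _)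
  have hexp : ∀ b ∈ S, t * w b + s * β b = E + β b / q := fun b hb => by
    have := hle b hb
    rw [hEa, ← mul_add] at this
    exact Nat.eq_of_mul_eq_mul_left hq this
  refine ⟨∑ b ∈ S, Polynomial.monomial (β b / q) (c b), E, β a % q, ?_, ?_, ?_, ?_⟩
  · intro h0
    have := congrArg (fun r => Polynomial.coeff r (β a / q)) h0
    simp only [Polynomial.finsetSum_coeff, Polynomial.coeff_monomial, Polynomial.coeff_zero] at this
    rw [← Finset.sum_filter] at this
    apply hc a ha
    rw [← this]
    congr 1
    refine Finset.filter_congr fun b hb => ⟨fun h => by rw [h], fun h => ?_⟩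
    rw [hdiv b hb, hdiv a ha, h]
    simp
  · obtain ⟨b, hb, hmax⟩ := Finset.exists_max_image S (fun b => β b / q) ⟨a, ha⟩
    refine ⟨b, hb, Polynomial.natDegree_sum_le_of_forall_le _ _ fun b' hb' => ?_⟩
    exact (Polynomial.natDegree_monomial_le _).trans (hmax b' hb')
  · rw [map_sum, Finset.mul_sum]
    refine Finset.sum_congr rfl fun b hb => ?_
    rw [hexp b hb, Polynomial.aeval_monomial]
    ring
  · rw [Polynomial.derivative_sum, map_sum, map_sum, Finset.mul_sum, Finset.mul_sum,
      ← Finset.sum_add_distrib, Finset.mul_sum]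
    refine Finset.sum_congr rfl fun b hb => ?_
    -- The common residue contributes a multiple of `p(z)`; the factor `β / q` is the action of `Z
    -- d/dZ` on monomials.
    have h1 : (β b : M) = ((β a % q : ℕ) : M) + q * ((β b / q : ℕ) : M) := by
      conv_lhs => rw [hdiv b hb]
      push_cast; ring
    rw [hexp b hb, Polynomial.derivative_monomial, Polynomial.aeval_monomial,
      Polynomial.aeval_monomial, h1]
    rcases Nat.eq_zero_or_pos (β b / q) with h0 | h0
    · simp [h0]; ring
    · obtain ⟨r, hr⟩ := Nat.exists_eq_succ_of_ne_zero h0.ne'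
      simp only [hr, Nat.succ_eq_add_one, Nat.add_sub_cancel, map_mul, map_natCast]
      ring

/-- `M⟦x⟧` is generated over `L⟦x⟧` by the elements `zᵃ xᵇ`. -/
theorem spannedBy_xPull (hP : Irreducible P) (hm : P.Monic)
    (hz : Polynomial.aeval z P = 0) (htop : Algebra.adjoin L {z} = ⊤) (q : ℕ+) {u : M}
    (hu : u ≠ 0) : SpannedBy (xPull (L := L) q u) (q * P.natDegree) := by
  have hspan : ∀ c : M, ∃ r : Fin P.natDegree → L, c = ∑ j, algebraMap L M (r j) * z ^ (j : ℕ) := by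
    intro c
    have hc : c ∈ Algebra.adjoin L {z} := htop ▸ Algebra.mem_top
    rw [Algebra.adjoin_singleton_eq_range_aeval] at hc
    obtain ⟨f, rfl⟩ := hc
    refine ⟨fun j => (f %ₘ P).coeff j, ?_⟩
    have h1 : Polynomial.aeval z f = Polynomial.aeval z (f %ₘ P) :=
      (Polynomial.aeval_modByMonic_eq_self_of_root hz).symm
    have h2 : (f %ₘ P).natDegree < P.natDegree :=
      Polynomial.natDegree_modByMonic_lt _ hm (fun h => by
        have := hP.natDegree_pos; simp [h] at this)
    show Polynomial.aeval z f = _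
    rw [h1, Polynomial.aeval_eq_sum_range' h2, Finset.sum_range]
    simp [Algebra.smul_def]
  choose r hr using hspan
  refine ⟨fun i => PowerSeries.X ^ ((finProdFinEquiv.symm i).1 : ℕ) *
    PowerSeries.C (z ^ ((finProdFinEquiv.symm i).2 : ℕ)), fun g => ?_⟩
  -- Exponents of `x` are split by residue modulo `q`, and each coefficient is expanded in powers of
  -- `z`. Division by `u ^ n` offsets the rescaling in `xPull`.
  refine ⟨fun i => PowerSeries.mk fun n =>
    r (PowerSeries.coeff (q * n + (finProdFinEquiv.symm i).1) g * (u ^ n)⁻¹)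
      (finProdFinEquiv.symm i).2, ?_⟩
  rw [finProdFinEquiv.symm.sum_comp (fun p : Fin (q : ℕ) × Fin P.natDegree =>
    xPull q u (PowerSeries.mk fun n => r (PowerSeries.coeff (q * n + p.1) g * (u ^ n)⁻¹) p.2) *
      (PowerSeries.X ^ (p.1 : ℕ) * PowerSeries.C (z ^ (p.2 : ℕ)))), Fintype.sum_prod_type]
  ext n
  rw [map_sum]
  have hqpos : 0 < (q : ℕ) := q.pos
  rw [Finset.sum_eq_single ⟨n % q, Nat.mod_lt _ hqpos⟩]
  · rw [map_sum]
    have hn : n - n % q = q * (n / q) := by have := Nat.mod_add_div n q; omega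
    have hterm : ∀ j : Fin P.natDegree, PowerSeries.coeff n (xPull q u (PowerSeries.mk fun n' =>
        r (PowerSeries.coeff (q * n' + n % q) g * (u ^ n')⁻¹) j) *
        (PowerSeries.X ^ (n % q) * PowerSeries.C (z ^ (j : ℕ)))) = u ^ (n / q) *
        (algebraMap L M (r (PowerSeries.coeff n g * (u ^ (n / q))⁻¹) j) * z ^ (j : ℕ)) := by
      intro j
      rw [← mul_assoc, PowerSeries.coeff_mul_C, PowerSeries.coeff_mul_X_pow',
        if_pos (Nat.mod_le _ _), coeff_xPull, hn, if_pos (dvd_mul_right _ _),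
        Nat.mul_div_cancel_left _ hqpos, PowerSeries.coeff_mk, Nat.div_add_mod]
      ring
    simp only [hterm]
    rw [← Finset.mul_sum, ← hr]
    field_simp
  · intro b _ hb
    rw [map_sum]
    refine Finset.sum_eq_zero fun j _ => ?_
    rw [← mul_assoc, PowerSeries.coeff_mul_C, PowerSeries.coeff_mul_X_pow']
    split_ifs with hle
    · rw [coeff_xPull, if_neg, zero_mul]
      rintro ⟨d, hd⟩
      apply hb
      ext
      show (b : ℕ) = n % q
      have : n = b + q * d := by dsimp only at hd hle; omega
      rw [this, Nat.add_mul_mod_self_left, Nat.mod_eq_of_lt b.2]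
    · rw [zero_mul]
  · simp

end Field

/-- The sequence `(x, φ_0, φ_1, …)`. -/
noncomputable def phiSeq {L : Type*} [Field L] (φ : ℕ → L⟦X⟧[X]) : ℕ → L⟦X⟧[X]
  | 0 => Polynomial.C PowerSeries.X
  | j + 1 => φ j

/-- The composite embedding `𝕂 0 → 𝕂 i`. -/
noncomputable def fromBase (𝕂 : ℕ → Type*) [∀ i, Field (𝕂 i)] [∀ i, Algebra (𝕂 i) (𝕂 (i + 1))] :
    ∀ i, 𝕂 0 →+* 𝕂 i
  | 0 => RingHom.id _
  | i + 1 => (algebraMap (𝕂 i) (𝕂 (i + 1))).comp (fromBase 𝕂 i)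

/-! ### Pull-backs along a run and divisibility by the minimal polynomials -/

namespace Run

variable {𝕂 : ℕ → Type*} [∀ i, Field (𝕂 i)] [∀ i, Algebra (𝕂 i) (𝕂 (i + 1))]
  {F : (𝕂 0)⟦X⟧[X]} {k : ℕ} (R : Run 𝕂 F k)

/-- The restriction of `π_i^*` to power series in `x`. -/
noncomputable def basePull : ∀ i, (𝕂 0)⟦X⟧ →+* (𝕂 i)⟦X⟧
  | 0 => RingHom.id _
  | i + 1 => (xPull (R.q i) (R.z i ^ R.t i)).comp (basePull i)

theorem pull_succ (i : ℕ) (f : (𝕂 0)⟦X⟧[X]) :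
    R.pull (i + 1) f = tauPull (shiftCoeff (R.G (i + 1)))
      (sigmaPull (R.q i) (R.m i) (R.s i) (R.t i) (R.z i) (R.pull i f)) := rfl

theorem pull_C (i : ℕ) (a : (𝕂 0)⟦X⟧) :
    R.pull i (Polynomial.C a) = Polynomial.C (R.basePull i a) := by
  induction i with
  | zero => simp [pull, basePull]
  | succ i ih => rw [pull_succ, ih, sigmaPull_C, tauPull_C]; rfl

theorem basePull_C (i : ℕ) (a : 𝕂 0) :
    R.basePull i (PowerSeries.C a) = PowerSeries.C (fromBase 𝕂 i a) := by
  induction i with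
  | zero => rfl
  | succ i ih => rw [basePull, RingHom.comp_apply, ih, xPull_C]; rfl

theorem constantCoeff_basePull (i : ℕ) (a : (𝕂 0)⟦X⟧) :
    PowerSeries.constantCoeff (R.basePull i a) = fromBase 𝕂 i (PowerSeries.constantCoeff a) := by
  induction i with
  | zero => rfl
  | succ i ih =>
    rw [basePull, RingHom.comp_apply, constantCoeff_xPull, ih]; rfl

theorem z_ne_zero {i : ℕ} (hi : i < k) : R.z i ≠ 0 :=
  root_ne_zero (R.edge i hi).coeff_zero_ne_zero_and_order.1 (R.root i hi)

theorem basePull_ne_zero {i : ℕ} (hi : i ≤ k) {a : (𝕂 0)⟦X⟧} (ha : a ≠ 0) :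
    R.basePull i a ≠ 0 := by
  induction i with
  | zero => exact ha
  | succ i ih =>
    intro h0
    apply ih (by omega)
    ext n
    have h1 := congrArg (PowerSeries.coeff (R.q i * n)) h0
    rw [basePull, RingHom.comp_apply, coeff_xPull, if_pos (dvd_mul_right _ _),
      Nat.mul_div_cancel_left _ (R.q i).pos, map_zero] at h1
    rcases mul_eq_zero.1 h1 with h2 | h2
    · exact absurd h2 (pow_ne_zero _ (pow_ne_zero _ (R.z_ne_zero (by omega))))
    · simpa using h2

theorem spannedBy_basePull {i : ℕ} (hi : i ≤ k) :
    SpannedBy (R.basePull i) (∏ j ∈ Finset.range i, (R.q j : ℕ) * (R.P j).natDegree) := by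
  induction i with
  | zero =>
    rw [Finset.prod_range_zero]
    exact ⟨fun _ => 1, fun b => ⟨fun _ => b, by simp [basePull]⟩⟩
  | succ i ih =>
    rw [Finset.prod_range_succ]
    have hik : i < k := by omega
    exact (ih (by omega)).comp (spannedBy_xPull (R.edge i hik).irreducible (R.edge i hik).monic
      (R.root i hik) (R.adjoin i hik) (R.q i) (pow_ne_zero _ (R.z_ne_zero hik)))

theorem isDistinguishedAt {i : ℕ} (h0 : 0 < i) (hi : i ≤ k) :
    (R.G i).IsDistinguishedAt (IsLocalRing.maximalIdeal (𝕂 i)⟦X⟧) := by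
  obtain ⟨j, rfl⟩ := Nat.exists_eq_succ_of_ne_zero h0.ne'
  obtain ⟨T, U, -, h⟩ := R.weierstrass j (by omega)
  exact h.isDistinguishedAt

theorem monic_G (hF : F.Monic) {i : ℕ} (hi : i ≤ k) : (R.G i).Monic := by
  rcases Nat.eq_zero_or_pos i with rfl | h0
  · rw [R.G_zero]; exact hF
  · exact (R.isDistinguishedAt h0 hi).monic

theorem monic_H (hF : F.Monic) {i : ℕ} (hi : i ≤ k) : (R.H i).Monic :=
  monic_tauPull _ (R.monic_G hF hi)

theorem natDegree_H (i : ℕ) : (R.H i).natDegree = (R.G i).natDegree := natDegree_tauPull _ _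

theorem constantCoeff_shift {i : ℕ} (h0 : 0 < i) (hi : i ≤ k) :
    PowerSeries.constantCoeff (shiftCoeff (R.G i)) = 0 :=
  constantCoeff_shiftCoeff (R.isDistinguishedAt h0 hi)

theorem red_H {i : ℕ} (h0 : 0 < i) (hi : i ≤ k) :
    red (R.H i) = Polynomial.X ^ (R.H i).natDegree := by
  rw [natDegree_H, H, red_tauPull (R.constantCoeff_shift h0 hi),
    red_of_isDistinguishedAt (R.isDistinguishedAt h0 hi)]

/-- Here `H_i` reduces to a positive power of `y` modulo `x`, so `H_i(x, 0)` has positive order.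
This order is `m ℓ N`. -/
theorem m_pos {i : ℕ} (h0 : 0 < i) (hi : i < k) : 0 < R.m i := by
  rw [Nat.pos_iff_ne_zero]
  intro hm
  have h1 := (R.edge i hi).coeff_zero_ne_zero_and_order.2
  rw [hm, zero_mul, zero_mul] at h1
  have h2 := (PowerSeries.order_eq_nat.1 h1).1
  have h3 := coeff_red (R.H i) 0
  rw [R.red_H h0 hi.le, Polynomial.coeff_X_pow, if_neg] at h3
  · exact h2 (by simpa [H] using h3.symm)
  · have := R.one_lt i hi
    rw [natDegree_H]; omega

/-- `π_i^* F` is `x^v H_i` up to a unit. -/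
theorem exists_pull_eq {i : ℕ} (hi : i ≤ k) :
    ∃ (v : ℕ) (U : (𝕂 i)⟦X⟧[X]), R.pull i F = Polynomial.C (PowerSeries.X ^ v) * (R.H i * U) ∧
      cc U ≠ 0 ∧ (0 < i ∨ v = 0 ∧ U = 1) := by
  induction i with
  | zero =>
    refine ⟨0, 1, ?_, by simp, Or.inr ⟨rfl, rfl⟩⟩
    simp [pull, H, R.G_zero]
  | succ i ih =>
    obtain ⟨v, U, hU, hcc, h⟩ := ih (by omega)
    have hik : i < k := by omega
    have hc := R.constantCoeff_shift (Nat.succ_pos i) hi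
    obtain ⟨T, W, hT, hW⟩ := R.weierstrass i hik
    obtain ⟨Q, rfl, hQ⟩ := exists_polynomial_of_isWeierstrassFactorization hW
    set σ := sigmaPull (L := 𝕂 i) (R.q i) (R.m i) (R.s i) (R.t i) (R.z i)
    set τ := tauPull (shiftCoeff (R.G (i + 1)))
    refine ⟨R.q i * v + R.q i * R.m i * (R.P i).natDegree * R.N i,
      Polynomial.C (PowerSeries.C (R.z i ^ (R.t i * v))) * τ Q * τ (σ U), ?_, ?_,
      Or.inl (Nat.succ_pos i)⟩
    · rw [pull_succ, hU, map_mul, sigmaPull_C_X_pow]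
      change τ (_ * σ (_ * _)) = _
      rw [map_mul σ, show σ (R.H i) = _ from hT]
      simp only [map_mul, pow_add, tauPull_C, H, τ]
      ring
    · rw [map_mul, map_mul, cc_tauPull hc, cc_tauPull hc, cc_eq (σ U), red_sigmaPull]
      · refine mul_ne_zero (mul_ne_zero ?_ hQ) ?_
        · rw [cc_apply, Polynomial.coeff_C_zero, PowerSeries.constantCoeff_C]
          exact pow_ne_zero _ (R.z_ne_zero hik)
        · rw [Polynomial.coeff_C_zero]
          exact (map_ne_zero _).2 hcc
      -- At the first step `m` may be `0`, but there the unit is `1`.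
      · exact h.imp (fun h => R.m_pos h hik) (fun h => h.2)

theorem natDegree_G_le {i : ℕ} (hi : i ≤ k) : (R.G i).natDegree ≤ F.natDegree := by
  induction i with
  | zero => rw [R.G_zero]
  | succ i ih =>
    have hik : i < k := by omega
    obtain ⟨T, W, hT, hW⟩ := R.weierstrass i hik
    refine (natDegree_le_of_isWeierstrassFactorization hW).trans ?_
    have h1 := natDegree_sigmaPull_le (R.q i) (R.m i) (R.s i) (R.t i) (R.z i)
      (tauPull (shiftCoeff (R.G i)) (R.G i))
    rw [hT, Polynomial.natDegree_C_mul (pow_ne_zero _ PowerSeries.X_ne_zero),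
      natDegree_tauPull] at h1
    exact h1.trans (ih (by omega))

theorem natCast_ne_zero (hchar : ringChar (𝕂 0) = 0 ∨ F.natDegree < ringChar (𝕂 0)) {n : ℕ}
    (h0 : 0 < n) (hn : n ≤ F.natDegree) (i : ℕ) : (n : 𝕂 i) ≠ 0 := by
  rw [← map_natCast (fromBase 𝕂 i)]
  refine (map_ne_zero _).2 fun h => ?_
  have := ringChar.dvd h
  rcases hchar with h1 | h1
  · rw [h1, zero_dvd_iff] at this; omega
  · exact absurd (Nat.le_of_dvd h0 this) (by omega)

/-- With `natCast_ne_zero`, this makes `q` and `ℓ` nonzero in every `𝕂 i`. -/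
theorem edge_le {i : ℕ} (hi : i < k) :
    (R.q i : ℕ) ≤ F.natDegree ∧ (R.P i).natDegree ≤ F.natDegree := by
  have h1 := (R.edge i hi).degree_le
  rw [natDegree_tauPull] at h1
  have h2 := h1.trans (R.natDegree_G_le hi.le)
  have h3 := (R.q i).pos
  have h4 := (R.edge i hi).irreducible.natDegree_pos
  have h5 := (R.edge i hi).N_pos
  constructor
  · calc (R.q i : ℕ) ≤ R.q i * ((R.P i).natDegree * R.N i) :=
        Nat.le_mul_of_pos_right _ (Nat.mul_pos h4 h5)
      _ ≤ _ := by rw [← mul_assoc]; exact h2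
  · calc (R.P i).natDegree ≤ (R.P i).natDegree * (R.q i * R.N i) :=
        Nat.le_mul_of_pos_right _ (Nat.mul_pos h3 h5)
      _ = R.q i * (R.P i).natDegree * R.N i := by ring
      _ ≤ _ := h2

/-- By Gauss's lemma `φ` stays irreducible over the fraction field. If it did not divide `ψ`, a
Bézout identity with denominators cleared would express a nonzero power series in `x` through `φ`
and `ψ`. Evaluation at `π_i(x, 0)` would kill it, against the injectivity of `basePull`. -/
theorem IsMinimalPolynomial.dvd {R : Run 𝕂 F k} {i : ℕ} (hi : i ≤ k) {φ ψ : (𝕂 0)⟦X⟧[X]}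
    (hφ : R.IsMinimalPolynomial i φ) (hψ : (R.pull i ψ).eval 0 = 0) : φ ∣ ψ := by
  let Q := FractionRing (𝕂 0)⟦X⟧
  have hinj : Function.Injective (algebraMap (𝕂 0)⟦X⟧ Q) := IsFractionRing.injective _ _
  rw [← Polynomial.map_dvd_map _ hinj hφ.monic]
  have hirr : Irreducible (φ.map (algebraMap (𝕂 0)⟦X⟧ Q)) :=
    (Polynomial.Monic.irreducible_iff_irreducible_map_fraction_map hφ.monic).1 hφ.irreducible
  by_contra hnd
  obtain ⟨u, w, huw⟩ := (hirr.coprime_iff_not_dvd).2 hnd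
  obtain ⟨a, ha0, ha⟩ := IsLocalization.integerNormalization_spec
    (nonZeroDivisors (𝕂 0)⟦X⟧) u
  obtain ⟨b, hb0, hb⟩ := IsLocalization.integerNormalization_spec
    (nonZeroDivisors (𝕂 0)⟦X⟧) w
  set u' := IsLocalization.integerNormalization (nonZeroDivisors (𝕂 0)⟦X⟧) u
  set w' := IsLocalization.integerNormalization (nonZeroDivisors (𝕂 0)⟦X⟧) w
  have h1 : Polynomial.C b * u' * φ + Polynomial.C a * w' * ψ =
      Polynomial.C (a * b) := by
    apply Polynomial.map_injective _ hinj
    simp only [Polynomial.map_add, Polynomial.map_mul, Polynomial.map_C, ha, hb]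
    rw [Algebra.smul_def, Algebra.smul_def]
    simp only [Polynomial.algebraMap_apply, map_mul]
    linear_combination (Polynomial.C ((algebraMap (𝕂 0)⟦X⟧ Q) a) *
      Polynomial.C ((algebraMap (𝕂 0)⟦X⟧ Q) b)) * huw
  have h2 := congrArg (fun f => Polynomial.eval 0 (R.pull i f)) h1
  simp only [map_add, map_mul, Polynomial.eval_add, Polynomial.eval_mul, hφ.eval_eq_zero, hψ,
    mul_zero, add_zero, pull_C, Polynomial.eval_C] at h2
  rw [eq_comm, ← map_mul] at h2
  exact R.basePull_ne_zero hi (mul_ne_zero (nonZeroDivisors.ne_zero ha0)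
    (nonZeroDivisors.ne_zero hb0)) h2

end Run

/-! ### The induction step: initial forms and the next minimal polynomial -/

namespace Run

variable {𝕂 : ℕ → Type*} [∀ i, Field (𝕂 i)] [∀ i, Algebra (𝕂 i) (𝕂 (i + 1))]
  {F : (𝕂 0)⟦X⟧[X]} {k : ℕ}

/-- The pull-backs by `π_i` of `φ_{-1}, …, φ_i` are `x^v` times a unit, the last one has the
additional factor `y`, and the products of the initial coefficients `l` with given
exponent of `y` and given weight are linearly independent. -/
structure Level (R : Run 𝕂 F k) (φ : ℕ → (𝕂 0)⟦X⟧[X]) (i : ℕ) (v : ℕ → ℕ) (l : ℕ → 𝕂 i) :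
    Prop where
  lower : ∀ j ≤ i, ∃ U, R.pull i (phiSeq φ j) = Polynomial.C (PowerSeries.X ^ v j) * U ∧
    cc U = l j ∧ (0 < i ∨ U = 1)
  top : ∃ U, R.pull i (phiSeq φ (i + 1)) =
    Polynomial.C (PowerSeries.X ^ v (i + 1)) * (Polynomial.X * U) ∧
    cc U = l (i + 1) ∧ (0 < i ∨ U = 1)
  ne_zero : ∀ j ≤ i + 1, l j ≠ 0
  pos : 0 < v 0
  indep : ∀ {ι : Type} (S : Finset ι) (B : ι → ℕ → ℕ) (f : ι → 𝕂 0) (b w : ℕ), S.Nonempty →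
    (∀ a ∈ S, f a ≠ 0) →
    (∀ a ∈ S, ∀ j < i, B a (j + 1) < (R.q j : ℕ) * (R.P j).natDegree) →
    (∀ a ∈ S, B a (i + 1) = b) →
    (∀ a ∈ S, ∑ j ∈ Finset.range (i + 2), B a j * v j = w) →
    (∀ a ∈ S, ∀ a' ∈ S, (∀ j < i + 2, B a j = B a' j) → a = a') →
    ∑ a ∈ S, fromBase 𝕂 i (f a) * ∏ j ∈ Finset.range (i + 2), l j ^ B a j ≠ 0

section Step

variable {R : Run 𝕂 F k} {φ : ℕ → (𝕂 0)⟦X⟧[X]} {i : ℕ} {v : ℕ → ℕ} {l : ℕ → 𝕂 i}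

/-- Under `σ`, `x^v` becomes `z^(t v) x^(q v)`, and the extra factor `y` of the top polynomial
becomes `x^m (y + z^s)`. Units contribute only their constant term. -/
theorem Level.hasInit (h : R.Level φ i v l) (hi : i < k) {j : ℕ} (hj : j ≤ i + 1) :
    HasInit (R.pull (i + 1) (phiSeq φ j)) (R.q i * v j + if j = i + 1 then R.m i else 0)
      (Polynomial.C (R.z i ^ (R.t i * v j) * algebraMap (𝕂 i) (𝕂 (i + 1)) (l j)) *
        (Polynomial.X + Polynomial.C (R.z i ^ R.s i)) ^ (if j = i + 1 then 1 else 0)) := by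
  rw [pull_succ]
  refine HasInit.tauPull ?_ (R.constantCoeff_shift (Nat.succ_pos i) hi)
  have hm : ∀ {U : (𝕂 i)⟦X⟧[X]}, (0 < i ∨ U = 1) → (0 < R.m i ∨ U = 1) :=
    fun hU => hU.imp_left fun h0 => R.m_pos h0 hi
  split_ifs with hji
  · subst hji
    obtain ⟨U, hU, hl, h0⟩ := h.top
    refine ⟨Polynomial.C (PowerSeries.C (R.z i ^ (R.t i * v (i + 1)))) *
      (Polynomial.X + Polynomial.C (PowerSeries.C (R.z i ^ R.s i))) *
      sigmaPull (R.q i) (R.m i) (R.s i) (R.t i) (R.z i) U, ?_, ?_⟩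
    · rw [hU, map_mul, map_mul, sigmaPull_C_X_pow, sigmaPull_X, pow_add, map_mul]
      ring
    · rw [map_mul, map_mul, red_sigmaPull (hm h0), hl]
      simp only [red_C, map_add, red_X, PowerSeries.constantCoeff_C, map_mul, pow_one]
      ring
  · obtain ⟨U, hU, hl, h0⟩ := h.lower j (by omega)
    refine ⟨Polynomial.C (PowerSeries.C (R.z i ^ (R.t i * v j))) *
      sigmaPull (R.q i) (R.m i) (R.s i) (R.t i) (R.z i) U, ?_, ?_⟩
    · rw [hU, map_mul, sigmaPull_C_X_pow, add_zero]
      ring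
    · rw [map_mul, red_sigmaPull (hm h0), hl]
      simp only [red_C, PowerSeries.constantCoeff_C, map_mul, pow_zero, mul_one]

theorem sum_weight_succ (R : Run 𝕂 F k) (i : ℕ) (v B : ℕ → ℕ) :
    ∑ j ∈ Finset.range (i + 2), B j * (R.q i * v j + if j = i + 1 then R.m i else 0) =
      R.q i * (∑ j ∈ Finset.range (i + 2), B j * v j) + R.m i * B (i + 1) := by
  simp only [mul_add, mul_ite, mul_zero, Finset.sum_add_distrib]
  rw [Finset.sum_ite_eq' (Finset.range (i + 2)) (i + 1), if_pos (by simp), Finset.mul_sum,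
    mul_comm (B (i + 1))]
  congr 1
  exact Finset.sum_congr rfl fun j _ => by ring

theorem prod_coeff_succ (R : Run 𝕂 F k) (i : ℕ) (v B : ℕ → ℕ) (l : ℕ → 𝕂 i) :
    ∏ j ∈ Finset.range (i + 2),
        (R.z i ^ (R.t i * v j) * algebraMap (𝕂 i) (𝕂 (i + 1)) (l j)) ^ B j =
      algebraMap (𝕂 i) (𝕂 (i + 1)) (∏ j ∈ Finset.range (i + 2), l j ^ B j) *
        R.z i ^ (R.t i * ∑ j ∈ Finset.range (i + 2), B j * v j) := by
  simp only [mul_pow, Finset.prod_mul_distrib, map_prod, map_pow, ← pow_mul]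
  rw [Finset.prod_pow_eq_pow_sum, Finset.mul_sum, mul_comm]
  congr 2
  exact Finset.sum_congr rfl fun j _ => by ring

theorem Level.hasInit_term (h : R.Level φ i v l) (hi : i < k) (B : ℕ → ℕ) {u : (𝕂 0)⟦X⟧} :
    HasInit (R.pull (i + 1)
        (Polynomial.C u * ∏ j ∈ Finset.range (i + 2), phiSeq φ j ^ B j))
      (R.q i * (∑ j ∈ Finset.range (i + 2), B j * v j) + R.m i * B (i + 1))
      (Polynomial.C (algebraMap (𝕂 i) (𝕂 (i + 1))
          (fromBase 𝕂 i (PowerSeries.constantCoeff u) *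
            ∏ j ∈ Finset.range (i + 2), l j ^ B j) *
          R.z i ^ (R.t i * ∑ j ∈ Finset.range (i + 2), B j * v j)) *
        (Polynomial.X + Polynomial.C (R.z i ^ R.s i)) ^ B (i + 1)) := by
  have h1 : HasInit (R.pull (i + 1) (Polynomial.C u)) 0
      (Polynomial.C (fromBase 𝕂 (i + 1) (PowerSeries.constantCoeff u))) :=
    ⟨_, by rw [pow_zero, map_one, one_mul], by rw [pull_C, red_C, constantCoeff_basePull]⟩
  have h2 := h1.mul (HasInit.prod (s := Finset.range (i + 2)) fun j hj =>
    (h.hasInit hi (j := j) (by rw [Finset.mem_range] at hj; omega)).pow (B j))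
  rw [← sum_weight_succ, map_mul, map_prod]
  simp only [map_pow]
  rw [zero_add] at h2
  convert h2 using 1
  rw [map_mul (algebraMap (𝕂 i) (𝕂 (i + 1))), mul_assoc (algebraMap _ _ _), ← prod_coeff_succ]
  simp only [mul_pow, Finset.prod_mul_distrib, ← pow_mul, map_mul, map_prod, map_pow]
  rw [Finset.prod_pow_eq_pow_sum, mul_assoc, mul_assoc, mul_assoc]
  congr 3
  simp

/-- Terms on the line with the same exponent of `φ_i` also have the same weight at level `i`, so
`indep` makes each coefficient of the edge polynomial nonzero. -/
theorem Level.exists_edge_polynomial (h : R.Level φ i v l) (hi : i < k) {ι : Type} {S : Finset ι}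
    {B : ι → ℕ → ℕ} {f : ι → 𝕂 0} {n : ℕ} (hS : S.Nonempty) (hf : ∀ a ∈ S, f a ≠ 0)
    (hB : ∀ a ∈ S, ∀ j < i, B a (j + 1) < (R.q j : ℕ) * (R.P j).natDegree)
    (hn : ∀ a ∈ S, R.q i * (∑ j ∈ Finset.range (i + 2), B a j * v j) +
      R.m i * B a (i + 1) = n)
    (hinj : ∀ a ∈ S, ∀ a' ∈ S, (∀ j < i + 2, B a j = B a' j) → a = a') :
    ∃ (p : (𝕂 i)[X]) (E b₀ : ℕ), p ≠ 0 ∧ (∃ b ∈ S, p.natDegree ≤ B b (i + 1) / R.q i) ∧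
      ∑ a ∈ S, algebraMap (𝕂 i) (𝕂 (i + 1))
          (fromBase 𝕂 i (f a) * ∏ j ∈ Finset.range (i + 2), l j ^ B a j) *
          R.z i ^ (R.t i * (∑ j ∈ Finset.range (i + 2), B a j * v j) + R.s i * B a (i + 1)) =
        R.z i ^ E * Polynomial.aeval (R.z i) p ∧
      ∑ a ∈ S, algebraMap (𝕂 i) (𝕂 (i + 1))
          (fromBase 𝕂 i (f a) * ∏ j ∈ Finset.range (i + 2), l j ^ B a j) * B a (i + 1) *
          R.z i ^ (R.t i * (∑ j ∈ Finset.range (i + 2), B a j * v j) + R.s i * B a (i + 1)) =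
        R.z i ^ E * (b₀ * Polynomial.aeval (R.z i) p +
          (R.q i : ℕ) * R.z i * Polynomial.aeval (R.z i) p.derivative) := by
  refine ARNP.exists_edge_polynomial hS (R.q i).pos (R.bezout i hi).1 hn (fun a ha => ?_) (R.z i)
  refine h.indep _ B f (B a (i + 1)) (∑ j ∈ Finset.range (i + 2), B a j * v j)
    ⟨a, by simp [ha]⟩ ?_ ?_ ?_ ?_ ?_
  · exact fun b hb => hf b (Finset.mem_filter.1 hb).1
  · exact fun b hb => hB b (Finset.mem_filter.1 hb).1
  · exact fun b hb => (Finset.mem_filter.1 hb).2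
  · intro b hb
    obtain ⟨hb, hb'⟩ := Finset.mem_filter.1 hb
    have := (hn b hb).trans (hn a ha).symm
    rw [hb', Nat.add_right_cancel_iff] at this
    exact Nat.eq_of_mul_eq_mul_left (R.q i).pos this
  · exact fun b hb b' hb' => hinj b (Finset.mem_filter.1 hb).1 b' (Finset.mem_filter.1 hb').1

/-- A combination of the products of `φ_0, …, φ_i` whose pull-back by `π_{i+1}` vanishes to the
first order along `y = 0`. -/
theorem Level.exists_top (h : R.Level φ i v l) (hi : i < k)
    (hchar : ringChar (𝕂 0) = 0 ∨ F.natDegree < ringChar (𝕂 0)) :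
    ∃ (ψ : (𝕂 0)⟦X⟧[X]) (n : ℕ) (U : (𝕂 (i + 1))⟦X⟧[X]),
      R.pull (i + 1) ψ = Polynomial.C (PowerSeries.X ^ n) * (Polynomial.X * U) ∧ cc U ≠ 0 := by
  classical
  have hpos : ∀ j ≤ i, 0 < (R.q j : ℕ) * (R.P j).natDegree := fun j hj =>
    Nat.mul_pos (R.q j).pos (R.edge j (by omega)).irreducible.natDegree_pos
  -- `some` indexes the products with all exponents below `q_j ℓ_j`, as many as the generators in
  -- `spannedBy_basePull`. `none` is the extra product `φ_i^(q_i ℓ_i)`, which forces a linear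
  -- relation.
  let I := Option (∀ j : Fin (i + 1), Fin ((R.q j : ℕ) * (R.P j).natDegree))
  let e : I → ℕ → ℕ := fun b j => match b with
    | none => if j = i then (R.q i : ℕ) * (R.P i).natDegree else 0
    | some g => if hj : j < i + 1 then g ⟨j, hj⟩ else 0
  have hlt : ∀ b : I, ∀ j < i, e b j < (R.q j : ℕ) * (R.P j).natDegree := by
    rintro (_ | g) j hj
    · simpa [e, hj.ne] using hpos j hj.le
    · simp only [e, dif_pos (show j < i + 1 by omega)]
      exact (g _).2
  have hle : ∀ b : I, e b i ≤ (R.q i : ℕ) * (R.P i).natDegree := by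
    rintro (_ | g)
    · simp [e]
    · simp only [e, dif_pos (Nat.lt_succ_self i)]
      exact (g _).2.le
  have hinj : ∀ b b' : I, (∀ j < i + 1, e b j = e b' j) → b = b' := by
    rintro (_ | g) (_ | g') hj
    · rfl
    · exfalso
      have h1 := hj i (Nat.lt_succ_self i)
      simp only [e, dif_pos (Nat.lt_succ_self i), if_true] at h1
      exact absurd (g' ⟨i, Nat.lt_succ_self i⟩).2 (by simp only [← h1]; omega)
    · exfalso
      have h1 := hj i (Nat.lt_succ_self i)
      simp only [e, dif_pos (Nat.lt_succ_self i), if_true] at h1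
      exact absurd (g ⟨i, Nat.lt_succ_self i⟩).2 (by simp only [h1]; omega)
    · congr 1
      funext j
      have := hj j j.2
      simp only [e, dif_pos j.2] at this
      exact Fin.ext this
  have hcard : ∏ j ∈ Finset.range (i + 1), (R.q j : ℕ) * (R.P j).natDegree < Fintype.card I := by
    rw [Fintype.card_option, Fintype.card_pi, Finset.prod_range]
    simp
  obtain ⟨a, ha0, ha⟩ := (R.spannedBy_basePull (show i + 1 ≤ k from hi)).exists_relation hcard
    fun b => (R.pull (i + 1) (∏ j ∈ Finset.range (i + 1), φ j ^ e b j)).eval 0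
  -- The power of `x` in the coefficient `a b` becomes the exponent of `φ_{-1}`; the cofactor `u b`
  -- is a unit.
  let B : I → ℕ → ℕ := fun b j => match j with
    | 0 => (a b).order.toNat
    | j + 1 => e b j
  have hu : ∀ b, ∃ u, a b = PowerSeries.X ^ (a b).order.toNat * u := fun b =>
    PowerSeries.X_pow_order_dvd
  choose u hu using hu
  have hterm : ∀ b, Polynomial.C (a b) * ∏ j ∈ Finset.range (i + 1), φ j ^ e b j =
      Polynomial.C (u b) * ∏ j ∈ Finset.range (i + 2), phiSeq φ j ^ B b j := by
    intro b
    conv_lhs => rw [hu b]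
    rw [Finset.prod_range_succ' _ (i + 1), map_mul, map_pow]
    simp only [phiSeq, B]
    ring
  let S : Finset I := Finset.univ.filter fun b => a b ≠ 0
  have hS : S.Nonempty := by
    obtain ⟨b, hb⟩ := Function.ne_iff.1 ha0
    exact ⟨b, by simpa [S] using hb⟩
  have hf : ∀ b ∈ S, PowerSeries.constantCoeff (u b) ≠ 0 := by
    intro b hb h0
    have h1 := PowerSeries.coeff_order (φ := a b) (by simpa [S] using hb)
    apply h1
    conv_lhs => rw [hu b]
    rw [PowerSeries.coeff_X_pow_mul', if_pos (by rw [← hu b]), ← hu b, Nat.sub_self]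
    simpa using h0
  let W : I → ℕ := fun b => ∑ j ∈ Finset.range (i + 2), B b j * v j
  obtain ⟨b₁, hb₁, hmin⟩ := Finset.exists_min_image S
    (fun b => R.q i * W b + R.m i * B b (i + 1)) hS
  set n := R.q i * W b₁ + R.m i * B b₁ (i + 1)
  have hinit := HasInit.sum (s := S) (n₀ := n) (fun b _ => h.hasInit_term hi (B b) (u := u b)) hmin
  set S' := S.filter fun b => R.q i * W b + R.m i * B b (i + 1) = n with hS'
  have hmem : ∀ b ∈ S', b ∈ S := fun b hb => (Finset.mem_filter.1 hb).1
  obtain ⟨p, E, b₀, hp0, ⟨b₂, -, hdeg⟩, h0, h1⟩ := h.exists_edge_polynomial hi (S := S') (B := B)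
    (f := fun b => PowerSeries.constantCoeff (u b)) (n := n) ⟨b₁, by simp [hS', hb₁, n]⟩
    (fun b hb => hf b (hmem b hb)) (fun b _ => hlt b) (fun b hb => (Finset.mem_filter.1 hb).2)
    (fun b _ b' _ hj => hinj b b' fun j hj' => hj (j + 1) (by omega))
  obtain ⟨g, hg, hr⟩ := hinit
  have heval : (R.pull (i + 1) (∑ b ∈ S, Polynomial.C (u b) *
      ∏ j ∈ Finset.range (i + 2), phiSeq φ j ^ B b j)).eval 0 = 0 := by
    simp only [← hterm]
    rw [map_sum, Polynomial.eval_finsetSum, Finset.sum_filter]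
    refine Eq.trans ?_ ha
    refine Finset.sum_congr rfl fun b _ => ?_
    split_ifs with hb
    · rw [map_mul, pull_C, Polynomial.eval_mul, Polynomial.eval_C]
    · rw [not_not] at hb
      rw [hb, map_zero, zero_mul]
  rw [map_sum, hg, Polynomial.eval_mul, Polynomial.eval_C, mul_eq_zero] at heval
  have hg0 : g.coeff 0 = 0 := by
    rw [Polynomial.coeff_zero_eq_eval_zero]
    exact heval.resolve_left (pow_ne_zero _ PowerSeries.X_ne_zero)
  obtain ⟨U, rfl⟩ := Polynomial.X_dvd_iff.2 hg0
  refine ⟨_, n, U, by rw [map_sum]; exact hg, ?_⟩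
  have hz := R.z_ne_zero hi
  have hdata := R.edge i hi
  have hℓ := natCast_ne_zero (F := F) hchar hdata.irreducible.natDegree_pos (R.edge_le hi).2 i
  have hq := natCast_ne_zero (F := F) hchar (R.q i).pos (R.edge_le hi).1 (i + 1)
  rw [map_mul, red_X] at hr
  -- The initial form is `y` times the reduction of `U`. Its value at `0` gives `p(z) = 0`, and its
  -- derivative at `0` is the constant term of `U`.
  have hc0 := congrArg (fun r => Polynomial.eval 0 r) hr
  have hc1 := congrArg (fun r => Polynomial.eval 0 (Polynomial.derivative r)) hr
  simp only [Polynomial.eval_mul, Polynomial.eval_X, zero_mul, Polynomial.eval_finsetSum,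
    Polynomial.eval_C, Polynomial.eval_pow, Polynomial.eval_add, zero_add,
    Polynomial.derivative_sum, Polynomial.derivative_mul, Polynomial.derivative_C,
    Polynomial.derivative_X, Polynomial.derivative_pow, Polynomial.derivative_add, add_zero,
    one_mul, mul_one] at hc0 hc1
  have hp : Polynomial.aeval (R.z i) p = 0 := by
    have h2 : R.z i ^ E * Polynomial.aeval (R.z i) p = 0 := by
      rw [← h0, hc0]
      refine Finset.sum_congr rfl fun b _ => ?_
      rw [pow_add, pow_mul (R.z i) (R.s i)]
      ring
    exact (mul_eq_zero.1 h2).resolve_left (pow_ne_zero _ hz)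
  -- The exponent of `φ_i` is at most `q ℓ`, so `deg p ≤ ℓ`.
  have hp' := aeval_derivative_ne_zero hdata.irreducible hdata.monic (R.root i hi) hp0
    (hdeg.trans (Nat.div_le_of_le_mul (hle b₂))) hp hℓ
  intro hU
  rw [cc_eq, Polynomial.coeff_zero_eq_eval_zero] at hU
  rw [hU] at hc1
  have h3 : R.z i ^ E * ((b₀ : 𝕂 (i + 1)) * Polynomial.aeval (R.z i) p +
      (R.q i : ℕ) * R.z i * Polynomial.aeval (R.z i) p.derivative) = 0 := by
    rw [← h1, ← mul_zero (R.z i ^ R.s i), hc1, Finset.mul_sum]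
    refine Finset.sum_congr rfl fun b _ => ?_
    rcases Nat.eq_zero_or_pos (B b (i + 1)) with hb | hb
    · simp [hb]
    · obtain ⟨r, hr⟩ := Nat.exists_eq_succ_of_ne_zero hb.ne'
      rw [hr, pow_add, pow_mul (R.z i) (R.s i)]
      simp only [Nat.succ_eq_add_one, Nat.add_sub_cancel]
      ring
  rw [hp, mul_zero, zero_add] at h3
  exact mul_ne_zero (pow_ne_zero _ hz) (mul_ne_zero (mul_ne_zero hq hz) hp') h3

/-- `φ` divides `ψ` and its pull-back already contains the factor `y`. After cancelling `y`, the
rest divides a power of `x` times a unit, hence is itself of that form. -/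
theorem IsMinimalPolynomial.pull_eq {φ ψ : (𝕂 0)⟦X⟧[X]} (hi : i ≤ k)
    (hφ : R.IsMinimalPolynomial i φ) {n : ℕ} {U : (𝕂 i)⟦X⟧[X]}
    (hψ : R.pull i ψ = Polynomial.C (PowerSeries.X ^ n) * (Polynomial.X * U)) (hU : cc U ≠ 0) :
    ∃ (a : ℕ) (A : (𝕂 i)⟦X⟧[X]),
      R.pull i φ = Polynomial.C (PowerSeries.X ^ a) * (Polynomial.X * A) ∧ cc A ≠ 0 := by
  obtain ⟨ρ, rfl⟩ := hφ.dvd hi (ψ := ψ) (by rw [hψ]; simp)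
  obtain ⟨A, hA⟩ := Polynomial.X_dvd_iff.2
    ((Polynomial.coeff_zero_eq_eval_zero _).trans hφ.eval_eq_zero)
  rw [map_mul, hA] at hψ
  have h1 : A * R.pull i ρ = Polynomial.C (PowerSeries.X ^ n) * U := by
    apply mul_left_cancel₀ (Polynomial.X_ne_zero (R := (𝕂 i)⟦X⟧))
    rw [← mul_assoc, hψ]; ring
  obtain ⟨a, A', rfl, hA'⟩ := eq_X_pow_mul_of_mul_eq h1 hU
  exact ⟨a, A', by rw [hA]; ring, hA'⟩

end Step

end Run

/-! ### Existence of all levels -/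

namespace Run

variable {𝕂 : ℕ → Type*} [∀ i, Field (𝕂 i)] [∀ i, Algebra (𝕂 i) (𝕂 (i + 1))]
  {F : (𝕂 0)⟦X⟧[X]} {k : ℕ} {R : Run 𝕂 F k} {φ : ℕ → (𝕂 0)⟦X⟧[X]}

/-- Here `φ_0 = y - c_0`, which pulls back to `y`. Independence is trivial because exponent and
weight determine the pair `(b_{-1}, b_0)`. -/
theorem level_zero (hφ : R.IsMinimalPolynomial 0 (φ 0)) :
    R.Level φ 0 (fun j => if j = 0 then 1 else 0) (fun _ => 1) := by
  have hφ0 : φ 0 = Polynomial.X - Polynomial.C (shiftCoeff (R.G 0)) := by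
    refine Polynomial.eq_of_monic_of_associated hφ.monic (Polynomial.monic_X_sub_C _) ?_
    refine (Irreducible.associated_of_dvd hφ.irreducible (Polynomial.irreducible_X_sub_C _) ?_)
    exact hφ.dvd (Nat.zero_le k) (by simp [pull])
  refine ⟨?_, ⟨1, ?_, by simp, Or.inr rfl⟩, fun _ _ => one_ne_zero, by simp, ?_⟩
  · intro j hj
    obtain rfl : j = 0 := by omega
    exact ⟨1, by simp [pull, phiSeq], by simp, Or.inr rfl⟩
  · simp [pull, phiSeq, hφ0]
  · intro ι S B f b w hS hf _ hb hw hinj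
    obtain ⟨a, ha⟩ := hS
    have hB : ∀ a ∈ S, B a 0 = w := fun a ha => by
      rw [← hw a ha]; simp
    have : S = {a} := by
      refine Finset.eq_singleton_iff_unique_mem.2 ⟨ha, fun a' ha' => hinj _ ha' _ ha ?_⟩
      intro j hj
      interval_cases j
      · rw [hB _ ha, hB _ ha']
      · rw [hb _ ha, hb _ ha']
    rw [this]
    simpa [fromBase] using hf a ha

theorem Level.succ {i : ℕ} {v : ℕ → ℕ} {l : ℕ → 𝕂 i} (h : R.Level φ i v l) (hi : i < k)
    (hchar : ringChar (𝕂 0) = 0 ∨ F.natDegree < ringChar (𝕂 0))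
    (hφ : R.IsMinimalPolynomial (i + 1) (φ (i + 1))) : ∃ v' l', R.Level φ (i + 1) v' l' := by
  obtain ⟨ψ, n, U, hψ, hU⟩ := h.exists_top hi hchar
  obtain ⟨a, A, hA, hA0⟩ := hφ.pull_eq hi hψ hU
  have hz := R.z_ne_zero hi
  let v' : ℕ → ℕ := fun j => if j = i + 2 then a else
    R.q i * v j + if j = i + 1 then R.m i else 0
  let l' : ℕ → 𝕂 (i + 1) := fun j => if j = i + 2 then cc A else
    R.z i ^ (R.t i * v j) * algebraMap (𝕂 i) (𝕂 (i + 1)) (l j) *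
      (R.z i ^ R.s i) ^ (if j = i + 1 then 1 else 0)
  have hv' : ∀ j < i + 2, v' j = R.q i * v j + if j = i + 1 then R.m i else 0 :=
    fun j hj => if_neg hj.ne
  have hl' : ∀ j < i + 2, l' j = R.z i ^ (R.t i * v j) * algebraMap (𝕂 i) (𝕂 (i + 1)) (l j) *
      (R.z i ^ R.s i) ^ (if j = i + 1 then 1 else 0) := fun j hj => if_neg hj.ne
  have hv2 : v' (i + 2) = a := if_pos rfl
  have hl2 : l' (i + 2) = cc A := if_pos rfl
  refine ⟨v', l', ?_, ⟨A, ?_, hl2.symm, Or.inl (Nat.succ_pos i)⟩, ?_, ?_, ?_⟩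
  · intro j hj
    obtain ⟨g, hg, hr⟩ := h.hasInit hi hj
    refine ⟨g, by rw [hv' j (by omega)]; exact hg, ?_, Or.inl (Nat.succ_pos i)⟩
    rw [cc_eq, hr, hl' j (by omega), Polynomial.coeff_zero_eq_eval_zero]
    simp only [Polynomial.eval_mul, Polynomial.eval_C, Polynomial.eval_pow, Polynomial.eval_add,
      Polynomial.eval_X, zero_add]
  · rw [hv2]; exact hA
  · intro j hj
    rcases Nat.lt_or_ge j (i + 2) with h1 | h1
    · rw [hl' j h1]
      exact mul_ne_zero (mul_ne_zero (pow_ne_zero _ hz)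
        ((map_ne_zero _).2 (h.ne_zero j (by omega)))) (pow_ne_zero _ (pow_ne_zero _ hz))
    · obtain rfl : j = i + 2 := by omega
      rw [hl2]; exact hA0
  · rw [hv' 0 (by omega)]
    exact Nat.add_pos_left (Nat.mul_pos (R.q i).pos h.pos) _
  · intro ι S B f b w hS hf hB hb hw hinj h0
    -- The top polynomial contributes the fixed weight `a b`. Removing it puts the remaining terms
    -- on the line `q w' + m β = w - a b`; this bound makes the natural subtraction exact.
    have hle : a * b ≤ w := by
      obtain ⟨c, hc⟩ := hS
      rw [← hw c hc, Finset.sum_range_succ _ (i + 2), hb c hc, hv2, mul_comm]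
      exact Nat.le_add_left _ _
    obtain ⟨p, E, -, hp, ⟨c, hc, hdeg⟩, hsum, -⟩ := h.exists_edge_polynomial hi (S := S) (B := B)
      (f := f) (n := w - a * b) hS hf (fun c hc j hj => hB c hc j (by omega)) (fun c hc => by
        have h1 := hw c hc
        rw [Finset.sum_range_succ _ (i + 2), hb c hc, hv2, Finset.sum_congr rfl fun j hj => by
          rw [hv' j (Finset.mem_range.1 hj)], sum_weight_succ, mul_comm b] at h1
        omega) (fun c hc c' hc' hj => hinj c hc c' hc' fun j hj' => by
          rcases Nat.lt_or_ge j (i + 2) with h1 | h1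
          · exact hj j h1
          · obtain rfl : j = i + 2 := by omega
            rw [hb c hc, hb c' hc'])
    -- The strict bound `b_i < q ℓ` in the expansion is used here: below degree `ℓ`, `p` cannot
    -- vanish at `z`.
    have hdeg' : p.natDegree < (R.P i).natDegree :=
      hdeg.trans_lt (Nat.div_lt_of_lt_mul (hB c hc i (Nat.lt_succ_self i)))
    have hne := aeval_ne_zero (R.edge i hi).irreducible (R.edge i hi).monic (R.root i hi) hp hdeg'
    refine mul_ne_zero (pow_ne_zero b hA0) (mul_ne_zero (pow_ne_zero E hz) hne) ?_
    rw [← hsum, ← h0, Finset.mul_sum]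
    refine Finset.sum_congr rfl fun c hc => ?_
    have hprod : ∏ j ∈ Finset.range (i + 2), l' j ^ B c j =
        algebraMap (𝕂 i) (𝕂 (i + 1)) (∏ j ∈ Finset.range (i + 2), l j ^ B c j) *
          R.z i ^ (R.t i * ∑ j ∈ Finset.range (i + 2), B c j * v j) *
          (R.z i ^ R.s i) ^ B c (i + 1) := by
      rw [← prod_coeff_succ, Finset.prod_congr rfl fun j hj => by
        rw [hl' j (Finset.mem_range.1 hj), mul_pow], Finset.prod_mul_distrib]
      congr 1
      rw [Finset.prod_eq_single (i + 1) (fun j _ hj => by simp [hj]) (by simp)]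
      simp
    rw [Finset.prod_range_succ _ (i + 2), hb c hc, hl2, hprod, pow_add, pow_mul (R.z i) (R.s i),
      map_mul]
    simp only [fromBase, RingHom.comp_apply]
    ring

theorem exists_level (hchar : ringChar (𝕂 0) = 0 ∨ F.natDegree < ringChar (𝕂 0))
    (hφ : ∀ i ≤ k, R.IsMinimalPolynomial i (φ i)) {i : ℕ} (hi : i ≤ k) :
    ∃ v l, R.Level φ i v l := by
  induction i with
  | zero => exact ⟨_, _, level_zero (hφ 0 hi)⟩
  | succ i ih =>
    obtain ⟨v, l, h⟩ := ih (by omega)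
    exact h.succ hi hchar (hφ (i + 1) hi)

end Run

/-! ### Supports -/

section Supp

variable {L : Type*} [Field L]

/-- The exponents `(i, j)` of the monomials `xʲ yⁱ` of `f`. -/
def supp (f : L⟦X⟧[X]) : Set (ℕ × ℕ) := {p | PowerSeries.coeff p.2 (f.coeff p.1) ≠ 0}

theorem coeff_coeff_mul (f g : L⟦X⟧[X]) (i j : ℕ) :
    PowerSeries.coeff j ((f * g).coeff i) =
      ∑ a ∈ Finset.HasAntidiagonal.antidiagonal i, ∑ b ∈ Finset.HasAntidiagonal.antidiagonal j,
        PowerSeries.coeff b.1 (f.coeff a.1) * PowerSeries.coeff b.2 (g.coeff a.2) := by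
  rw [Polynomial.coeff_mul, map_sum]
  exact Finset.sum_congr rfl fun a _ => PowerSeries.coeff_mul _ _ _

theorem exists_le_of_mem_supp_mul {f g : L⟦X⟧[X]} {p : ℕ × ℕ} (hp : p ∈ supp (f * g)) :
    ∃ p' ∈ supp f, p' ≤ p := by
  have hp : PowerSeries.coeff p.2 ((f * g).coeff p.1) ≠ 0 := hp
  rw [coeff_coeff_mul] at hp
  obtain ⟨a, ha, h1⟩ := Finset.exists_ne_zero_of_sum_ne_zero hp
  obtain ⟨b, hb, h2⟩ := Finset.exists_ne_zero_of_sum_ne_zero h1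
  have h3 : a.1 ≤ p.1 := Finset.HasAntidiagonal.antidiagonal.fst_le ha
  have h4 : b.1 ≤ p.2 := Finset.HasAntidiagonal.antidiagonal.fst_le hb
  exact ⟨(a.1, b.1), left_ne_zero_of_mul h2, h3, h4⟩

/-- At a minimal exponent of `f`, the only contribution to the product comes from the constant term
of `g`. -/
theorem mem_supp_mul_of_minimal {f g : L⟦X⟧[X]} (hg : cc g ≠ 0) {p : ℕ × ℕ}
    (hp : Minimal (· ∈ supp f) p) : p ∈ supp (f * g) := by
  show PowerSeries.coeff p.2 ((f * g).coeff p.1) ≠ 0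
  have hz : ∀ a ∈ Finset.HasAntidiagonal.antidiagonal p.1, ∀ b ∈ Finset.HasAntidiagonal.antidiagonal p.2,
      (a.1, b.1) ≠ p → PowerSeries.coeff b.1 (f.coeff a.1) = 0 := by
    intro a ha b hb hne
    by_contra h0
    have h1 : a.1 ≤ p.1 := Finset.HasAntidiagonal.antidiagonal.fst_le ha
    have h2 : b.1 ≤ p.2 := Finset.HasAntidiagonal.antidiagonal.fst_le hb
    have hle : (a.1, b.1) ≤ p := ⟨h1, h2⟩
    exact hne (le_antisymm hle (hp.2 h0 hle))
  rw [coeff_coeff_mul, Finset.sum_eq_single (p.1, 0), Finset.sum_eq_single (p.2, 0)]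
  · exact mul_ne_zero hp.1 (by simpa [cc_apply] using hg)
  · intro b hb hne
    rw [hz (p.1, 0) (by simp) b hb, zero_mul]
    intro h
    have h1 : b.1 = p.2 := by rw [← h]
    have h2 := Finset.HasAntidiagonal.mem_antidiagonal.1 hb
    exact hne (Prod.ext h1 (by dsimp only; omega))
  · simp
  · intro a ha hne
    refine Finset.sum_eq_zero fun b hb => ?_
    rw [hz a ha b hb, zero_mul]
    intro (h : (a.1, b.1) = p)
    have h1 : a.1 = p.1 := by rw [← h]
    have h2 := Finset.HasAntidiagonal.mem_antidiagonal.1 ha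
    exact hne (Prod.ext h1 (by dsimp only; omega))
  · simp

theorem coeff_coeff_X_pow_mul (f : L⟦X⟧[X]) (n i j : ℕ) :
    PowerSeries.coeff j ((Polynomial.C (PowerSeries.X ^ n) * f).coeff i) =
      if n ≤ j then PowerSeries.coeff (j - n) (f.coeff i) else 0 := by
  rw [Polynomial.coeff_C_mul, PowerSeries.coeff_X_pow_mul']

theorem coeff_coeff_monomial_mul (f : L⟦X⟧[X]) (n b i j : ℕ) :
    PowerSeries.coeff j ((Polynomial.C (PowerSeries.X ^ n) * (Polynomial.X ^ b * f)).coeff i) =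
      if b ≤ i ∧ n ≤ j then PowerSeries.coeff (j - n) (f.coeff (i - b)) else 0 := by
  rw [coeff_coeff_X_pow_mul, Polynomial.coeff_X_pow_mul']
  by_cases h1 : b ≤ i <;> by_cases h2 : n ≤ j <;> simp [h1, h2]

theorem exists_minimal_le {S : Set (ℕ × ℕ)} {p : ℕ × ℕ} (hp : p ∈ S) :
    ∃ p' ≤ p, Minimal (· ∈ S) p' :=
  exists_minimal_le_of_wellFoundedLT (· ∈ S) p hp

end Supp

/-! ### Exponents -/

/-- The extension by zero of an exponent. -/
def extend {n : ℕ} (B : Fin n → ℕ) : ℕ → ℕ := fun j => if h : j < n then B ⟨j, h⟩ else 0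

theorem extend_apply {n : ℕ} (B : Fin n → ℕ) (j : Fin n) : extend B j = B j := dif_pos j.2

theorem extend_of_lt {n : ℕ} (B : Fin n → ℕ) {j : ℕ} (hj : j < n) : extend B j = B ⟨j, hj⟩ :=
  dif_pos hj

theorem phi_eq {L : Type*} [Field L] {k : ℕ} (φ : ℕ → L⟦X⟧[X]) (j : Fin (k + 2)) : Phi φ k j = phiSeq φ j := by
  refine Fin.cases ?_ (fun j => ?_) j
  · rfl
  · simp [Phi, phiSeq]

theorem prod_phi {L : Type*} [Field L] {k : ℕ} (φ : ℕ → L⟦X⟧[X]) (B : Fin (k + 2) → ℕ) :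
    ∏ j, Phi φ k j ^ B j = ∏ j ∈ Finset.range (k + 2), phiSeq φ j ^ extend B j := by
  rw [Finset.prod_range]
  exact Finset.prod_congr rfl fun j _ => by rw [phi_eq, extend_apply]

/-! ### Monomials of the pulled-back expansion -/

namespace Run

variable {𝕂 : ℕ → Type*} [∀ i, Field (𝕂 i)] [∀ i, Algebra (𝕂 i) (𝕂 (i + 1))]
  {F : (𝕂 0)⟦X⟧[X]} {k : ℕ} {R : Run 𝕂 F k} {φ : ℕ → (𝕂 0)⟦X⟧[X]}
  {v : ℕ → ℕ} {l : ℕ → 𝕂 k}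

theorem Level.exists_pull_prod {i : ℕ} {v : ℕ → ℕ} {l : ℕ → 𝕂 i} (h : R.Level φ i v l)
    (B : ℕ → ℕ) : ∃ U, R.pull i (∏ j ∈ Finset.range (i + 2), phiSeq φ j ^ B j) =
      Polynomial.C (PowerSeries.X ^ (∑ j ∈ Finset.range (i + 2), B j * v j)) *
        (Polynomial.X ^ B (i + 1) * U) ∧
      cc U = ∏ j ∈ Finset.range (i + 2), l j ^ B j ∧ (0 < i ∨ U = 1) := by
  choose! U hU hl h1 using h.lower
  obtain ⟨V, hV, hVl, hV1⟩ := h.top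
  refine ⟨(∏ j ∈ Finset.range (i + 1), U j ^ B j) * V ^ B (i + 1), ?_, ?_, ?_⟩
  · rw [Finset.prod_range_succ, Finset.sum_range_succ, map_mul, map_prod, map_pow, hV,
      Finset.prod_congr rfl fun j hj => by
        rw [map_pow, hU j (by simpa [Nat.lt_succ_iff] using hj), mul_pow],
      Finset.prod_mul_distrib, pow_add, map_mul, mul_pow, mul_pow, ← Finset.prod_pow_eq_pow_sum,
      map_prod]
    simp only [← map_pow, ← pow_mul, mul_comm (B _) (v _)]
    ring
  · rw [map_mul, map_prod, map_pow, hVl, Finset.prod_range_succ _ (i + 1)]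
    congr 1
    exact Finset.prod_congr rfl fun j hj => by
      rw [map_pow, hl j (by simpa [Nat.lt_succ_iff] using hj)]
  · rcases Nat.eq_zero_or_pos i with rfl | hi
    · refine Or.inr ?_
      rw [hV1.resolve_left (lt_irrefl 0)]
      simp [(h1 0 le_rfl).resolve_left (lt_irrefl 0)]
    · exact Or.inl hi

theorem Level.xVal_pull {i : ℕ} {v : ℕ → ℕ} {l : ℕ → 𝕂 i} (h : R.Level φ i v l) {j : ℕ}
    (hj : j ≤ i + 1) : xVal (R.pull i (phiSeq φ j)) = v j := by
  have hred : ∀ U : (𝕂 i)⟦X⟧[X], cc U = l j → red U ≠ 0 := fun U hU h0 =>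
    h.ne_zero j hj (by rw [← hU, cc_eq, h0, Polynomial.coeff_zero])
  rcases Nat.lt_or_ge i j with h1 | h1
  · obtain rfl : j = i + 1 := by omega
    obtain ⟨U, hU, hl, -⟩ := h.top
    rw [hU, xVal_C_X_pow_mul]
    rw [map_mul, red_X]
    exact mul_ne_zero Polynomial.X_ne_zero (hred U hl)
  · obtain ⟨U, hU, hl, -⟩ := h.lower j h1
    rw [hU, xVal_C_X_pow_mul (hred U hl)]

theorem Level.weight_eq (h : R.Level φ k v l) (B : Fin (k + 2) → ℕ) :
    R.weight φ B = ((∑ j ∈ Finset.range (k + 2), extend B j * v j : ℕ) : ℕ∞) := by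
  rw [weight, Finset.sum_range]
  push_cast
  refine Finset.sum_congr rfl fun j _ => ?_
  rw [phi_eq, extend_apply, Run.v, h.xVal_pull (Nat.lt_succ_iff.1 j.2)]

section Expansion

variable {f : (Fin (k + 2) → ℕ) → 𝕂 0}

/-- The pull-back of `x` is divisible by `x`, so a remainder divisible by `x^n` does not affect
coefficients of order below `n`. -/
theorem Level.coeff_pull (h : R.Level φ k v l) (hf : R.IsExpansion φ f) {i j n : ℕ} (hn : j < n) :
    PowerSeries.coeff j ((R.pull k F).coeff i) = ∑ B ∈ (hf.finite n).toFinset,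
      fromBase 𝕂 k (f B) * PowerSeries.coeff j ((R.pull k
        (∏ j ∈ Finset.range (k + 2), phiSeq φ j ^ extend B j)).coeff i) := by
  obtain ⟨g, hg⟩ := hf.sum_eq n
  rw [sub_eq_iff_eq_add] at hg
  have hg1 := congrArg (fun r => PowerSeries.coeff j ((R.pull k r).coeff i)) hg
  refine hg1.trans ?_
  have hX : Polynomial.C PowerSeries.X ∣ R.pull k (Polynomial.C PowerSeries.X) := by
    obtain ⟨U, hU, -⟩ := h.lower 0 (Nat.zero_le k)
    rw [show Polynomial.C PowerSeries.X = phiSeq φ 0 from rfl, hU]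
    exact Dvd.dvd.mul_right (map_dvd _ (dvd_pow_self _ h.pos.ne')) _
  obtain ⟨g', hg'⟩ := hX
  rw [map_add, map_mul, map_pow, map_pow, hg', mul_pow, ← map_pow, mul_assoc,
    Polynomial.coeff_add, map_add, coeff_coeff_X_pow_mul, if_neg (by omega), zero_add, map_sum,
    Polynomial.finsetSum_coeff, map_sum]
  refine Finset.sum_congr rfl fun B _ => ?_
  rw [prod_phi, map_mul, pull_C, Polynomial.coeff_C_mul]
  rw [basePull_C, PowerSeries.coeff_C_mul]

/-- The exponents of `y` and the weights of the terms of the expansion. -/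
def terms (f : (Fin (k + 2) → ℕ) → 𝕂 0) (v : ℕ → ℕ) : Set (ℕ × ℕ) :=
  {p | ∃ B, f B ≠ 0 ∧ p = (extend B (k + 1), ∑ j ∈ Finset.range (k + 2), extend B j * v j)}

theorem Level.exists_term (h : R.Level φ k v l) (hf : R.IsExpansion φ f) {p : ℕ × ℕ}
    (hp : p ∈ supp (R.pull k F)) : ∃ e ∈ terms f v, e ≤ p ∧ (0 < k ∨ e = p) := by
  have hp : PowerSeries.coeff p.2 ((R.pull k F).coeff p.1) ≠ 0 := hp
  rw [h.coeff_pull hf (Nat.lt_succ_self p.2)] at hp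
  obtain ⟨B, hB, h1⟩ := Finset.exists_ne_zero_of_sum_ne_zero hp
  obtain ⟨U, hU, -, h0⟩ := h.exists_pull_prod (extend B)
  have h2 := right_ne_zero_of_mul h1
  rw [hU, coeff_coeff_monomial_mul] at h2
  split_ifs at h2 with hle
  · refine ⟨_, ⟨B, fun h3 => by simp [h3] at hB, rfl⟩, hle, h0.imp_right fun hU1 => ?_⟩
    rw [hU1, Polynomial.coeff_one] at h2
    split_ifs at h2 with h3
    · rw [PowerSeries.coeff_one] at h2
      have h4 : p.2 - _ = 0 := by_contra fun h4 => h2 (if_neg h4)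
      exact Prod.ext (by dsimp only; omega) (by dsimp only; omega)
    · simp at h2
  · exact absurd rfl h2

theorem Level.mem_supp_of_minimal (h : R.Level φ k v l) (hf : R.IsExpansion φ f) {e : ℕ × ℕ}
    (he : Minimal (· ∈ terms f v) e) : e ∈ supp (R.pull k F) := by
  classical
  show PowerSeries.coeff e.2 ((R.pull k F).coeff e.1) ≠ 0
  rw [h.coeff_pull hf (Nat.lt_succ_self e.2)]
  set S := (hf.finite (e.2 + 1)).toFinset
  have hS : ∀ B ∈ S, f B ≠ 0 := fun B hB => by
    simp only [S, Set.Finite.mem_toFinset] at hB; exact hB.1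
  have hterm : ∀ B ∈ S, fromBase 𝕂 k (f B) * PowerSeries.coeff e.2 ((R.pull k
      (∏ j ∈ Finset.range (k + 2), phiSeq φ j ^ extend B j)).coeff e.1) =
      if (extend B (k + 1), ∑ j ∈ Finset.range (k + 2), extend B j * v j) = e then
        fromBase 𝕂 k (f B) * ∏ j ∈ Finset.range (k + 2), l j ^ extend B j else 0 := by
    intro B hB
    obtain ⟨U, hU, hl, -⟩ := h.exists_pull_prod (extend B)
    rw [hU, coeff_coeff_monomial_mul]
    split_ifs with h1 h2 h2
    · rw [← hl, ← h2]; simp [cc_apply]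
    -- A term whose monomial divides that of `e` must sit exactly at `e`, by minimality.
    · exact absurd (le_antisymm h1 (he.2 ⟨B, hS B hB, rfl⟩ h1)) h2
    · exact absurd ⟨(congrArg Prod.fst h2).le, (congrArg Prod.snd h2).le⟩ h1
    · rw [mul_zero]
  rw [Finset.sum_congr rfl hterm, ← Finset.sum_filter]
  have hmem : ∀ B ∈ S.filter fun B =>
      (extend B (k + 1), ∑ j ∈ Finset.range (k + 2), extend B j * v j) = e,
      f B ≠ 0 ∧ extend B (k + 1) = e.1 ∧
        ∑ j ∈ Finset.range (k + 2), extend B j * v j = e.2 := fun B hB => by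
    obtain ⟨h1, h2⟩ := Finset.mem_filter.1 hB
    exact ⟨hS B h1, congrArg Prod.fst h2, congrArg Prod.snd h2⟩
  refine h.indep _ extend f e.1 e.2 ?_ (fun B hB => (hmem B hB).1) ?_
    (fun B hB => (hmem B hB).2.1) (fun B hB => (hmem B hB).2.2) ?_
  · obtain ⟨B, hB, hBe⟩ := he.1
    refine ⟨B, Finset.mem_filter.2 ⟨?_, hBe.symm⟩⟩
    simp only [S, Set.Finite.mem_toFinset]
    refine ⟨hB, Nat.lt_succ_iff.2 ?_⟩
    have h1 : extend B 0 * v 0 ≤ e.2 := by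
      rw [hBe]
      exact Finset.single_le_sum (f := fun j => extend B j * v j) (fun _ _ => Nat.zero_le _)
        (Finset.mem_range.2 (Nat.succ_pos _))
    exact (Nat.le_mul_of_pos_right _ h.pos).trans h1
  · intro B hB j hj
    have := hf.mem_exponents B (hmem B hB).1 ⟨j, hj⟩
    rw [extend_of_lt B (by omega)]
    exact this
  · intro B _ B' _ hj
    funext j
    rw [← extend_apply B j, ← extend_apply B' j, hj j j.2]

theorem Level.w_eq (h : R.Level φ k v l) {v₀ : ℕ} (hv₀ : R.v F = v₀) (i : ℕ) (u : ℤ) :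
    R.w φ f i = u ↔ (∃ B, f B ≠ 0 ∧ extend B (k + 1) = i ∧
      ((∑ j ∈ Finset.range (k + 2), extend B j * v j : ℕ) : ℤ) - v₀ = u) ∧
      ∀ B, f B ≠ 0 → extend B (k + 1) = i →
        u ≤ ((∑ j ∈ Finset.range (k + 2), extend B j * v j : ℕ) : ℤ) - v₀ := by
  have hlast : ∀ B : Fin (k + 2) → ℕ, B (Fin.last (k + 1)) = extend B (k + 1) := fun B =>
    (extend_apply B (Fin.last (k + 1))).symm
  have hle : ∀ n : ℕ, (n : ℕ∞) ≤ (⨅ B ∈ {B : Fin (k + 2) → ℕ | B (Fin.last (k + 1)) = i ∧ f B ≠ 0},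
      R.weight φ B) ↔ ∀ B, f B ≠ 0 → extend B (k + 1) = i →
        n ≤ ∑ j ∈ Finset.range (k + 2), extend B j * v j := by
    intro n
    simp only [le_iInf_iff, h.weight_eq, Nat.cast_le, Set.mem_ofPred_eq, hlast]
    exact ⟨fun H B h1 h2 => H B ⟨h2, h1⟩, fun H B hB => H B hB.2 hB.1⟩
  rw [w, hv₀]
  set m := ⨅ B ∈ {B : Fin (k + 2) → ℕ | B (Fin.last (k + 1)) = i ∧ f B ≠ 0}, R.weight φ B
  constructor
  · intro hm
    obtain ⟨n, hn, hu⟩ := WithTop.map_eq_some_iff.1 hm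
    have hn : m = (n : ℕ∞) := hn
    simp only [ENat.toNat_natCast] at hu
    have h1 := (hle n).1 hn.ge
    refine ⟨?_, fun B h2 h3 => by have := h1 B h2 h3; omega⟩
    by_contra! hne
    -- The infimum is attained: otherwise `n + 1` would also be a lower bound.
    have h2 : ((n + 1 : ℕ) : ℕ∞) ≤ m := (hle (n + 1)).2 fun B h2 h3 => by
      have h4 := h1 B h2 h3
      have h5 := hne B h2 h3
      omega
    rw [hn, Nat.cast_le] at h2
    omega
  · rintro ⟨⟨B, h1, h2, h3⟩, h4⟩
    have hm : m = ((∑ j ∈ Finset.range (k + 2), extend B j * v j : ℕ) : ℕ∞) := by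
      refine le_antisymm ?_ ((hle _).2 fun B' h5 h6 => ?_)
      · rw [← h.weight_eq]
        exact iInf₂_le B ⟨(hlast B).trans h2, h1⟩
      · have := h4 B' h5 h6
        omega
    rw [ENat.toNat_natCast, ← h3]
    exact congrArg (WithTop.map fun n : ℕ => (n : ℤ) - v₀) hm

end Expansion

end Run

end ARNP

/-! ### Comparison of the two polygons -/

open ARNP ARNP.Run in
theorem mainTheorem6 {𝕂 : ℕ → Type*} [∀ i, Field (𝕂 i)] [∀ i, Algebra (𝕂 i) (𝕂 (i + 1))]
    [PerfectField (𝕂 0)]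
    (F : (𝕂 0)⟦X⟧[X]) (hF : F.Monic) (hd : 0 < F.natDegree)
    (hchar : ringChar (𝕂 0) = 0 ∨ F.natDegree < ringChar (𝕂 0))
    (k : ℕ) (R : ARNP.Run 𝕂 F k)
    (φ : ℕ → (𝕂 0)⟦X⟧[X]) (hφ : ∀ i ≤ k, R.IsMinimalPolynomial i (φ i))
    (f : (Fin (k + 2) → ℕ) → 𝕂 0) (hf : R.IsExpansion φ f) :
    ARNP.newtonPolygon (R.H k) =
      ARNP.lowerHull (ARNP.points (R.w φ f) (R.H k).natDegree) := by
  obtain ⟨v, l, h⟩ := exists_level hchar hφ le_rfl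
  obtain ⟨v₀, U, hU, hcc, hU0⟩ := R.exists_pull_eq le_rfl
  have hmon := R.monic_H hF le_rfl
  set N := (R.H k).natDegree with hN
  have hv₀ : R.v F = v₀ := by
    rw [Run.v, hU, xVal_C_X_pow_mul]
    rw [map_mul]
    refine mul_ne_zero (hmon.map PowerSeries.constantCoeff).ne_zero fun h0 => hcc ?_
    rw [cc_eq, h0, Polynomial.coeff_zero]
  have hshift : ∀ i j, (i, j) ∈ supp (R.H k * U) → (i, j + v₀) ∈ supp (R.pull k F) := by
    intro i j hij
    show PowerSeries.coeff _ (Polynomial.coeff _ _) ≠ 0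
    rw [hU, coeff_coeff_X_pow_mul, if_pos (Nat.le_add_left _ _), Nat.add_sub_cancel]
    exact hij
  have hw : ∀ e ∈ terms f v, ∃ u : ℤ, R.w φ f e.1 = u ∧ u ≤ (e.2 : ℤ) - v₀ := by
    rintro e ⟨B, hB, rfl⟩
    obtain ⟨n, ⟨B', hB', h1, h2⟩, hmin⟩ := WellFounded.has_min (wellFounded_lt (α := ℕ))
      {n | ∃ B', f B' ≠ 0 ∧ extend B' (k + 1) = extend B (k + 1) ∧
        ∑ j ∈ Finset.range (k + 2), extend B' j * v j = n} ⟨_, B, hB, rfl, rfl⟩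
    have hmin' : ∀ B', f B' ≠ 0 → extend B' (k + 1) = extend B (k + 1) →
        n ≤ ∑ j ∈ Finset.range (k + 2), extend B' j * v j := fun B' h3 h4 =>
      not_lt.1 (hmin _ ⟨B', h3, h4, rfl⟩)
    refine ⟨(n : ℤ) - v₀, (h.w_eq hv₀ _ _).2 ⟨⟨B', hB', h1, by rw [h2]⟩, fun B'' h3 h4 => ?_⟩, ?_⟩
    · have := hmin' B'' h3 h4
      omega
    · have := hmin' B hB rfl
      dsimp only
      omega
  set S := points (fun i => WithTop.map (fun n : ℕ => (n : ℤ)) ((R.H k).coeff i).order) N with hS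
  set T := points (R.w φ f) N with hT
  -- A minimal exponent of `H_k` survives multiplication by the unit, so it is, after the shift, a
  -- monomial of `π_k^*F` and lies above a term of the expansion.
  have hST : ∀ p ∈ S, ∃ p' ∈ T, p'.1 ≤ p.1 ∧ p'.2 ≤ p.2 := by
    rintro p ⟨i, hi, y, hy, rfl⟩
    obtain ⟨j, hj, rfl⟩ := WithTop.map_eq_some_iff.1 hy
    have hmem : (i, j) ∈ supp (R.H k) := (PowerSeries.order_eq_nat.1 hj).1
    obtain ⟨⟨i', j'⟩, hle, hmin⟩ := exists_minimal_le hmem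
    obtain ⟨e, he, hle', -⟩ := h.exists_term hf (hshift _ _ (mem_supp_mul_of_minimal hcc hmin))
    obtain ⟨u, hu, hu'⟩ := hw e he
    have h1 : e.1 ≤ i := hle'.1.trans hle.1
    have h2 : e.2 ≤ j' + v₀ := hle'.2
    have h3 : j' ≤ j := hle.2
    refine ⟨(e.1, u), ⟨e.1, h1.trans hi, u, hu, rfl⟩, Nat.cast_le.2 h1, ?_⟩
    have h4 : u ≤ (j : ℤ) := by omega
    exact Int.cast_le.2 h4
  have hTS : ∀ p ∈ T, ∃ p' ∈ S, p'.1 ≤ p.1 ∧ p'.2 ≤ p.2 := by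
    rintro p ⟨i, hi, u, hu, rfl⟩
    obtain ⟨⟨B, hB, rfl, rfl⟩, -⟩ := (h.w_eq hv₀ i u).1 hu
    -- Cancellation is excluded only at minimal terms, so the given term is replaced by a minimal
    -- one below it.
    obtain ⟨e, hle, hmin⟩ := exists_minimal_le (S := terms f v) ⟨B, hB, rfl⟩
    have he : PowerSeries.coeff e.2 ((R.pull k F).coeff e.1) ≠ 0 := h.mem_supp_of_minimal hf hmin
    rw [hU, coeff_coeff_X_pow_mul] at he
    split_ifs at he with hv
    · obtain ⟨⟨i', j'⟩, hp, hle'⟩ := exists_le_of_mem_supp_mul (p := (e.1, e.2 - v₀)) he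
      have h0 : (R.H k).coeff i' ≠ 0 := fun h0 => hp (by simp [h0])
      obtain ⟨n, hn⟩ := ENat.ne_top_iff_exists.1
        (PowerSeries.order_eq_top.not.2 h0)
      have hnj : n ≤ j' := by
        have := PowerSeries.order_le j' hp
        rw [← hn] at this
        exact_mod_cast this
      have h1 : i' ≤ extend B (k + 1) := hle'.1.trans hle.1
      have h2 : j' ≤ e.2 - v₀ := hle'.2
      have h3 : e.2 ≤ ∑ j ∈ Finset.range (k + 2), extend B j * v j := hle.2
      refine ⟨((i' : ℝ), ((n : ℤ) : ℝ)),
        ⟨i', Polynomial.le_natDegree_of_ne_zero h0, n, ?_, rfl⟩, Nat.cast_le.2 h1, ?_⟩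
      · exact congrArg (WithTop.map fun n : ℕ => (n : ℤ)) hn.symm
      · have h4 : (n : ℤ) ≤
            ((∑ j ∈ Finset.range (k + 2), extend B j * v j : ℕ) : ℤ) - v₀ := by omega
        exact Int.cast_le.2 h4
    · exact absurd rfl he
  have hNS : ((N : ℝ), (0 : ℝ)) ∈ S := by
    refine ⟨N, le_rfl, 0, ?_, by simp⟩
    dsimp only
    rw [hN, hmon.coeff_natDegree, PowerSeries.order_one]
    rfl
  have hS0 : ∀ p ∈ S, 0 ≤ p.2 := by
    rintro p ⟨i, -, y, hy, rfl⟩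
    obtain ⟨j, -, rfl⟩ := WithTop.map_eq_some_iff.1 hy
    simp
  have hkey : ∃ p ∈ T, p.1 = (N : ℝ) ∧ p.2 ≤ 0 := by
    -- For `k = 0` all units are `1`, so the leading monomial of `H_0` is exactly a term. For `k >
    -- 0`, going from `(N, 0)` to `T` and back to `S` ends at ordinate `0`. Since `H_k` reduces to
    -- `y^N` modulo `x`, this is `(N, 0)` again, and the abscissa never moved.
    rcases Nat.eq_zero_or_pos k with hk | hk
    · obtain ⟨hv, hU1⟩ := hU0.resolve_left (by omega)
      have hmem : (N, 0) ∈ supp (R.H k * U) := by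
        show PowerSeries.coeff _ (Polynomial.coeff _ _) ≠ 0
        rw [hU1, mul_one]
        simp only [hN, hmon.coeff_natDegree, PowerSeries.coeff_one, if_true]
        exact one_ne_zero
      obtain ⟨e, he, -, h1⟩ := h.exists_term hf (hshift _ _ hmem)
      have h2 := h1.resolve_left (by omega)
      obtain ⟨u, hu, hu'⟩ := hw e he
      rw [h2] at hu hu'
      refine ⟨((N : ℝ), (u : ℝ)), ⟨N, le_rfl, u, hu, rfl⟩, rfl, ?_⟩
      have h4 : u ≤ 0 := by dsimp only at hu'; omega
      exact Int.cast_nonpos.2 h4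
    · obtain ⟨p, hp, h1, h2⟩ := hST _ hNS
      refine ⟨p, hp, le_antisymm h1 ?_, h2⟩
      obtain ⟨r, hr, h3, h4⟩ := hTS p hp
      have h5 := hS0 r hr
      obtain ⟨i, hi, y, hy, rfl⟩ := hr
      obtain ⟨j, hj, rfl⟩ := WithTop.map_eq_some_iff.1 hy
      have h6 : j = 0 := by
        have : ((j : ℤ) : ℝ) ≤ 0 := h4.trans h2
        have : (j : ℤ) ≤ 0 := by exact_mod_cast this
        omega
      have h7 := (PowerSeries.order_eq_nat.1 hj).1
      rw [h6, PowerSeries.coeff_zero_eq_constantCoeff_apply, ← coeff_red, R.red_H hk le_rfl,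
        Polynomial.coeff_X_pow] at h7
      have h8 : i = N := by_contra fun h8 => h7 (if_neg h8)
      rw [h8] at h3
      exact h3
  have hNT : ((N : ℝ), (0 : ℝ)) ∈ T := by
    obtain ⟨p, hp, h1, h2⟩ := hkey
    obtain ⟨r, hr, -, h4⟩ := hTS p hp
    have : p = ((N : ℝ), (0 : ℝ)) := Prod.ext h1 (le_antisymm h2 ((hS0 r hr).trans h4))
    rw [← this]
    exact hp
  have hle : ∀ w : ℕ → WithTop ℤ, ∀ p ∈ points w N, p.1 ≤ (N : ℝ) := by
    rintro w p ⟨i, hi, y, -, rfl⟩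
    exact Nat.cast_le.2 hi
  exact lowerHull_congr hST hTS (hle _) (hle _) hS0 hNS hNT
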